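/- For integers $n\ge 1$, $p\ge 2$ let $\boldsymbol J=(J_{i_1,\dots,i_p})_{1\le i_1,\dots,i_p\le n}$ have i.i.d. standard normal entries, and for $\sigma\in\Sigma_n=\{-1,1\}^n$ let $$H(\sigma)=n^{-\frac{p+1}{2}}\sum_{1\le i_1,\dots,i_p\le n}J_{i_1,\dots,i_p}\,\sigma_{i_1}\cdots\sigma_{i_p}$$ be the Ising pure $p$-spin Hamiltonian. For $m\in\mathbb N$, $m\ge 1$, $\gamma>0$ and $0<\eta<\xi<1$ let $S(\gamma,m,\xi,\eta)$ be the (random) set of all $m$-tuples $(\sigma^{(1)},\dots,\sigma^{(m)})$ in $\Sigma_n$ such that $H(\sigma^{(t)})\ge\gamma\sqrt{2\ln 2}$ for all $1\le t\le m$ and $n^{-1}\langle\sigma^{(t)},\sigma^{(\ell)}\rangle\in[\xi-\eta,\xi]$ for all $1\le t<\ell\le m$. Call $\gamma>0$ $m$-admissible if for all $0<\eta<\xi<1$ there is a $P^*\in\mathbb N$ such that for every fixed $p\ge P^*$, $\lim_{n\to\infty}\mathbb P[S(\gamma,m,\xi,\eta)\ne\varnothing]=1$. Call $\gamma>0$ $m$-inadmissible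 if there are $\xi\in(0,1)$, $\eta_0\in(0,\xi)$ and $\hat P\in\mathbb N$ such that for every fixed $p\ge\hat P$ and every $0<\eta\le\eta_0$, $\lim_{n\to\infty}\mathbb P[S(\gamma,m,\xi,\eta)\ne\varnothing]=0$. (Since $S(\gamma,m,\xi,\eta)$ increases with $\eta$, it is equivalent to require this for one $\eta\in(0,\xi)$.) Theorem. For every integer $m\ge 1$, the symmetric $m$-OGP of the Ising pure $p$-spin glass has a sharp phase transition at $\gamma_m=1/\sqrt m$, that is, $$\sup\{\gamma>0:\gamma\text{ is }m\text{-admissible}\}=\frac1{\sqrt m}=\inf\{\gamma>0:\gamma\text{ is }m\text{-inadmissible}\}.$$ Moreover, every $0<\gamma<1/\sqrt m$ is $m$-admissible and every $\gamma>1/\sqrt m$ is $m$-inadmissible. -/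

import Mathlib

open MeasureTheory ProbabilityTheory Filter Topology

noncomputable section

namespace PSpin

/-- The configuration space `Σ_n = {-1, 1}^n`; the units of `ℤ` are exactly `1` and `-1`. -/
abbrev Config (n : ℕ) : Type := Fin n → ℤˣ

/-- The spin of site `i`, as a real number. -/
def spin {n : ℕ} (σ : Config n) (i : Fin n) : ℝ := ((σ i : ℤ) : ℝ)

/-- Order-`p` tensors `J = (J_{i_1, …, i_p} : 1 ≤ i_1, …, i_p ≤ n)`. -/
abbrev Disorder (n p : ℕ) : Type := (Fin p → Fin n) → ℝ

/-- The law of the disorder: the entries are i.i.d. standard normal. -/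
def disorderLaw (n p : ℕ) : Measure (Disorder n p) :=
  Measure.pi fun _ : Fin p → Fin n => gaussianReal 0 1

/-- The pure `p`-spin Hamiltonian
`H(σ) = n^{-(p+1)/2} ∑_{i_1, …, i_p} J_{i_1, …, i_p} σ_{i_1} ⋯ σ_{i_p}`. -/
def hamiltonian {n p : ℕ} (J : Disorder n p) (σ : Config n) : ℝ :=
  (n : ℝ) ^ (-((p : ℝ) + 1) / 2) * ∑ i : Fin p → Fin n, J i * ∏ k : Fin p, spin σ (i k)

/-- The normalized overlap `n⁻¹ ⟨σ, τ⟩`. -/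
def overlap {n : ℕ} (σ τ : Config n) : ℝ :=
  (n : ℝ)⁻¹ * ∑ i : Fin n, spin σ i * spin τ i

/-- The set `S(γ, m, ξ, η)` of `m`-tuples of configurations with energies at least `γ √(2 ln 2)`
and all pairwise overlaps in `[ξ - η, ξ]`. -/
def solutionTuples {n p : ℕ} (J : Disorder n p) (γ : ℝ) (m : ℕ) (ξ η : ℝ) :
    Set (Fin m → Config n) :=
  {σ | (∀ t : Fin m, γ * Real.sqrt (2 * Real.log 2) ≤ hamiltonian J (σ t)) ∧
    ∀ t l : Fin m, t < l → overlap (σ t) (σ l) ∈ Set.Icc (ξ - η) ξ}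

/-- `ℙ[S(γ, m, ξ, η) ≠ ∅]` for the `p`-spin model on `n` sites. -/
def existenceProb (n p : ℕ) (γ : ℝ) (m : ℕ) (ξ η : ℝ) : ℝ :=
  (disorderLaw n p).real {J | (solutionTuples J γ m ξ η).Nonempty}

/-- `γ` is `m`-admissible. -/
def MAdmissible (m : ℕ) (γ : ℝ) : Prop :=
  ∀ ξ η : ℝ, 0 < η → η < ξ → ξ < 1 →
    ∃ P : ℕ, ∀ p : ℕ, P ≤ p →
      Tendsto (fun n : ℕ => existenceProb n p γ m ξ η) atTop (𝓝 1)

/-- `γ` is `m`-inadmissible: there are an overlap value `ξ` and a threshold `P` that work for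
all sufficiently small `η`. (As `S(γ, m, ξ, η)` increases with `η`, this is the same as asking
for a single `η`.) -/
def MInadmissible (m : ℕ) (γ : ℝ) : Prop :=
  ∃ ξ η₀ : ℝ, 0 < η₀ ∧ η₀ < ξ ∧ ξ < 1 ∧
    ∃ P : ℕ, ∀ p : ℕ, P ≤ p → ∀ η : ℝ, 0 < η → η ≤ η₀ →
      Tendsto (fun n : ℕ => existenceProb n p γ m ξ η) atTop (𝓝 0)

/-- The symmetric `m`-OGP exhibits a sharp phase transition at `γm`:
`sup {γ > 0 : γ is m-admissible} = γm = inf {γ > 0 : γ is m-inadmissible}`. -/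
def SharpPhaseTransition (m : ℕ) (γm : ℝ) : Prop :=
  IsLUB {γ : ℝ | 0 < γ ∧ MAdmissible m γ} γm ∧ IsGLB {γ : ℝ | 0 < γ ∧ MInadmissible m γ} γm

end PSpin

end

noncomputable section

namespace PSpin

/-! The energies form a centred Gaussian process with covariance `overlap σ τ ^ p / n`.
Configurations whose overlap stays away from ±1 therefore become nearly independent as p grows, and
an m-tuple of them reaches level γ√(2 ln 2) with probability about 2^(-n m γ²). The threshold mγ² =
1 is where this cost balances an entropy of 2^n tuples.

Above the threshold, take ξ near 1. All members of a tuple then lie in a small cap around the first,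
so there are only 2^n e^(o(n)) candidates (o(n) as the cap shrinks). Large p makes ξ^p negligible,
and the first moment tends to 0 (`existenceProb_le`).

Below the threshold, fix one tuple with the prescribed overlaps and use its gauge orbit: multiplying
all members by a common sign vector ε keeps their overlaps and gives 2^n tuples. Two of them are
strongly correlated only if ε' lies in one of m² small antipodal caps, so the second moment method
applies (`sq_le_measureReal_iUnion`). Since p is fixed, r^p does not vanish and this yields only
probability e^(-sn), with s as small as desired. The second moment is therefore run at a slightly
higher level, and Gaussian isoperimetry turns the weak bound into probability tending to 1 at the
original level (`measureReal_mul_one_sub_existenceProb_le`), the energy being n^(-1/2)-Lipschitz in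
the disorder. Isoperimetry itself comes from Prékopa–Leindler in dimension one and tensorisation. -/

/-! ### One-dimensional Brunn–Minkowski and Prékopa–Leindler. -/

theorem volume_add_volume_le_of_isCompact {K L C : Set ℝ} (hK : IsCompact K) (hL : IsCompact L)
    (hK0 : K.Nonempty) (hL0 : L.Nonempty) (h : ∀ a ∈ K, ∀ b ∈ L, a + b ∈ C) :
    volume K + volume L ≤ volume C := by
  obtain ⟨a, ha, ha'⟩ := hK.exists_isGreatest hK0
  obtain ⟨b, hb, hb'⟩ := hL.exists_isLeast hL0
  -- With a the maximum of K and b the minimum of L, the translates K + b and a + L lie in C and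
  -- meet only at a + b.
  set K' := (fun x => x + b) '' K
  set L' := (fun x => a + x) '' L
  have h1 : volume K' = volume K := by simp [K']
  have h2 : volume L' = volume L := by simp [L']
  have hL'm : MeasurableSet L' := (hL.image (by fun_prop)).measurableSet
  have h3 : volume (K' ∩ L') = 0 := by
    refine measure_mono_null (t := {a + b}) ?_ (by simp)
    rintro _ ⟨⟨x, hx, rfl⟩, ⟨y, hy, hxy⟩⟩
    have := ha' hx
    have := hb' hy
    simp only [Set.mem_singleton_iff] at *
    linarith
  have h4 := measure_union_add_inter (μ := volume) K' hL'm
  rw [h3, add_zero, h1, h2] at h4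
  rw [← h4]
  refine measure_mono ?_
  rintro _ (⟨x, hx, rfl⟩ | ⟨x, hx, rfl⟩)
  · exact h x hx b hb
  · exact h a ha x hx

/-- The one-dimensional Brunn–Minkowski inequality. -/
theorem volume_add_volume_le {A B C : Set ℝ} (hA : MeasurableSet A) (hB : MeasurableSet B)
    (hA0 : A.Nonempty) (hB0 : B.Nonempty) (h : ∀ a ∈ A, ∀ b ∈ B, a + b ∈ C) :
    volume A + volume B ≤ volume C := by
  obtain ⟨a, ha⟩ := hA0
  obtain ⟨b, hb⟩ := hB0
  rw [hA.measure_eq_iSup_isCompact, hB.measure_eq_iSup_isCompact]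
  simp_rw [iSup_and']
  refine ENNReal.biSup_add_biSup_le' ⟨∅, by simp⟩ ⟨∅, by simp⟩ ?_
  rintro K ⟨hKA, hK⟩ L ⟨hLB, hL⟩
  calc volume K + volume L ≤ volume (insert a K) + volume (insert b L) := by
        gcongr <;> exact Set.subset_insert _ _
    _ ≤ volume C := volume_add_volume_le_of_isCompact (hK.insert a) (hL.insert b)
        (Set.insert_nonempty _ _) (Set.insert_nonempty _ _) fun x hx y hy =>
          h x (Set.insert_subset ha hKA hx) y (Set.insert_subset hb hLB hy)

/-- Layer cake plus Brunn–Minkowski at each level t. Supremum one for both f and g makes their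
superlevel sets nonempty for every t < 1, and empty from 1 on. -/
theorem lintegral_add_lintegral_le_of_sup_one {f g w : ℝ → ℝ} (hf : Measurable f)
    (hg : Measurable g) (hw : Measurable w) (hf0 : ∀ x, 0 ≤ f x) (hg0 : ∀ x, 0 ≤ g x)
    (hw0 : ∀ x, 0 ≤ w x) (hf1 : ∀ x, f x ≤ 1) (hg1 : ∀ x, g x ≤ 1)
    (hfs : ∀ t < 1, ∃ x, t < f x) (hgs : ∀ t < 1, ∃ x, t < g x)
    (h : ∀ x y, f x * g y ≤ w (x + y) ^ 2) :
    (∫⁻ x, ENNReal.ofReal (f x)) + ∫⁻ x, ENNReal.ofReal (g x) ≤ ∫⁻ x, ENNReal.ofReal (w x) := by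
  rw [lintegral_eq_lintegral_meas_lt _ (.of_forall hf0) hf.aemeasurable,
    lintegral_eq_lintegral_meas_lt _ (.of_forall hg0) hg.aemeasurable,
    lintegral_eq_lintegral_meas_lt _ (.of_forall hw0) hw.aemeasurable]
  rw [← lintegral_add_left]
  · refine setLIntegral_mono' measurableSet_Ioi fun t ht => ?_
    rcases lt_or_ge t 1 with h1 | h1
    · refine volume_add_volume_le (measurableSet_lt measurable_const hf)
        (measurableSet_lt measurable_const hg) (hfs t h1) (hgs t h1) ?_
      intro a (ha : t < f a) b (hb : t < g b)
      have ht : 0 < t := ht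
      exact lt_of_pow_lt_pow_left₀ 2 (hw0 _) (by nlinarith [h a b])
    · have h2 : {a | t < f a} = ∅ := by
        ext a; simpa using (hf1 a).trans h1
      have h3 : {a | t < g a} = ∅ := by
        ext a; simpa using (hg1 a).trans h1
      simp [h2, h3]
  · exact Antitone.measurable fun s t hst => measure_mono fun x (hx : t < f x) => hst.trans_lt hx

theorem exists_scaling_sup_one {f : ℝ → ℝ} (hb : BddAbove (Set.range f))
    {x₀ : ℝ} (hx₀ : 0 < f x₀) :
    ∃ F : ℝ, 0 < F ∧ (∀ x, f x / F ≤ 1) ∧ ∀ t < 1, ∃ x, t < f x / F := by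
  have hF : 0 < ⨆ x, f x := hx₀.trans_le (le_ciSup hb x₀)
  refine ⟨⨆ x, f x, hF, fun x => (div_le_one hF).2 (le_ciSup hb x), fun t ht => ?_⟩
  obtain ⟨x, hx⟩ := exists_lt_of_lt_ciSup (show t * (⨆ x, f x) < ⨆ x, f x by nlinarith)
  exact ⟨x, (lt_div_iff₀ hF).2 hx⟩

/-- The one-dimensional Prékopa–Leindler inequality for a bounded dominating function; the
dominating function is evaluated at `x + y` instead of the midpoint. -/
theorem lintegral_mul_lintegral_le {f g w : ℝ → ℝ} (hf : Measurable f)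
    (hg : Measurable g) (hw : Measurable w) (hf0 : ∀ x, 0 ≤ f x) (hg0 : ∀ x, 0 ≤ g x)
    (hw0 : ∀ x, 0 ≤ w x) {W : ℝ} (hW : ∀ x, w x ≤ W)
    (h : ∀ x y, f x * g y ≤ w (x + y) ^ 2) :
    4 * ((∫⁻ x, ENNReal.ofReal (f x)) * ∫⁻ x, ENNReal.ofReal (g x)) ≤
      (∫⁻ x, ENNReal.ofReal (w x)) ^ 2 := by
  by_cases hfz : ∀ x, f x = 0
  · simp [hfz]
  by_cases hgz : ∀ x, g x = 0
  · simp [hgz]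
  push Not at hfz hgz
  obtain ⟨a, ha⟩ := hfz
  obtain ⟨b, hb⟩ := hgz
  replace ha := lt_of_le_of_ne (hf0 a) ha.symm
  replace hb := lt_of_le_of_ne (hg0 b) hb.symm
  have hle : ∀ x y, f x * g y ≤ W ^ 2 := fun x y =>
    (h x y).trans (pow_le_pow_left₀ (hw0 _) (hW _) 2)
  have hbf : BddAbove (Set.range f) := ⟨W ^ 2 / g b, by
    rintro _ ⟨x, rfl⟩; exact (le_div_iff₀ hb).2 (hle x b)⟩
  have hbg : BddAbove (Set.range g) := ⟨W ^ 2 / f a, by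
    rintro _ ⟨x, rfl⟩; exact (le_div_iff₀ ha).2 (by linarith [hle a x, mul_comm (f a) (g x)])⟩
  obtain ⟨F, hF, hF1, hFs⟩ := exists_scaling_sup_one hbf ha
  obtain ⟨G, hG, hG1, hGs⟩ := exists_scaling_sup_one hbg hb
  have hFG : 0 < √(F * G) := Real.sqrt_pos.2 (mul_pos hF hG)
  have key := lintegral_add_lintegral_le_of_sup_one (f := fun x => f x / F) (g := fun x => g x / G)
    (w := fun x => w x / √(F * G)) (hf.div_const _) (hg.div_const _) (hw.div_const _)
    (fun x => div_nonneg (hf0 x) hF.le) (fun x => div_nonneg (hg0 x) hG.le)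
    (fun x => div_nonneg (hw0 x) hFG.le) hF1 hG1 hFs hGs (fun x y => by
      rw [div_pow, Real.sq_sqrt (mul_pos hF hG).le, div_mul_div_comm]
      gcongr
      exact h x y)
  have hdiv : ∀ (u : ℝ → ℝ) (c : ℝ), 0 < c → Measurable u →
      ∫⁻ x, ENNReal.ofReal (u x / c) = ENNReal.ofReal c⁻¹ * ∫⁻ x, ENNReal.ofReal (u x) := by
    intro u c hc hu
    rw [← lintegral_const_mul _ hu.ennreal_ofReal]
    refine lintegral_congr fun x => ?_
    rw [← ENNReal.ofReal_mul (by positivity), div_eq_inv_mul]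
  rw [hdiv f F hF hf, hdiv g G hG hg, hdiv w _ hFG hw] at key
  set I := ∫⁻ x, ENNReal.ofReal (f x)
  set J := ∫⁻ x, ENNReal.ofReal (g x)
  set K := ∫⁻ x, ENNReal.ofReal (w x)
  have h1 : ENNReal.ofReal (√(F * G)) ^ 2 *
      (ENNReal.ofReal F⁻¹ * ENNReal.ofReal G⁻¹) = 1 := by
    rw [← ENNReal.ofReal_pow hFG.le, Real.sq_sqrt (mul_pos hF hG).le,
      ← ENNReal.ofReal_mul (by positivity), ← ENNReal.ofReal_mul (by positivity)]
    rw [show F * G * (F⁻¹ * G⁻¹) = 1 by field_simp]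
    simp
  have h2 : ENNReal.ofReal (√(F * G)) ^ 2 * ENNReal.ofReal (√(F * G))⁻¹ ^ 2 = 1 := by
    rw [← mul_pow, ← ENNReal.ofReal_mul (by positivity), mul_inv_cancel₀ hFG.ne']
    simp
  -- AM–GM turns the additive bound for the rescaled functions into the multiplicative one; the
  -- scalings F, G and √(FG) then cancel.
  have amgm : ∀ x y : ENNReal, 4 * (x * y) ≤ (x + y) ^ 2 := by
    intro x y
    by_cases hx : x = ⊤
    · by_cases hy : y = 0 <;> simp [hx, hy]
    by_cases hy : y = ⊤
    · by_cases hy : x = 0 <;> simp [*]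
    lift x to NNReal using hx
    lift y to NNReal using hy
    norm_cast
    rw [← NNReal.coe_le_coe]
    push_cast
    nlinarith [sq_nonneg ((x : ℝ) - y)]
  calc 4 * (I * J) = ENNReal.ofReal (√(F * G)) ^ 2 *
        (4 * ((ENNReal.ofReal F⁻¹ * I) * (ENNReal.ofReal G⁻¹ * J))) := by
        rw [show ENNReal.ofReal (√(F * G)) ^ 2 *
          (4 * ((ENNReal.ofReal F⁻¹ * I) * (ENNReal.ofReal G⁻¹ * J))) = ENNReal.ofReal (√(F * G)) ^ 2 *
          (ENNReal.ofReal F⁻¹ * ENNReal.ofReal G⁻¹) * (4 * (I * J)) by ring, h1, one_mul]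
    _ ≤ ENNReal.ofReal (√(F * G)) ^ 2 * (ENNReal.ofReal F⁻¹ * I + ENNReal.ofReal G⁻¹ * J) ^ 2 := by
        gcongr; exact amgm _ _
    _ ≤ ENNReal.ofReal (√(F * G)) ^ 2 * (ENNReal.ofReal (√(F * G))⁻¹ * K) ^ 2 := by gcongr
    _ = K ^ 2 := by rw [mul_pow, ← mul_assoc, h2, one_mul]

/-! ### Gaussian isoperimetry. -/

/-- For the Gaussian density φ, φ((x+y)/2)² = e^((x-y)²/4) φ(x)φ(y), so Prékopa–Leindler applies to
uφ, vφ and φ(·/2). The latter has integral 2, which cancels the factor 4. -/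
theorem lintegral_mul_lintegral_gaussianReal_le {u v : ℝ → ENNReal} (hu : Measurable u)
    (hv : Measurable v) (h : ∀ x y, u x * v y ≤ ENNReal.ofReal (Real.exp ((x - y) ^ 2 / 4))) :
    (∫⁻ x, u x ∂gaussianReal 0 1) * ∫⁻ x, v x ∂gaussianReal 0 1 ≤ 1 := by
  by_cases hu0 : ∀ x, u x = 0
  · simp [hu0]
  by_cases hv0 : ∀ x, v x = 0
  · simp [hv0]
  push Not at hu0 hv0
  obtain ⟨a, ha⟩ := hu0
  obtain ⟨b, hb⟩ := hv0
  have huf : ∀ x, u x ≠ ⊤ := fun x hx => by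
    have := h x b
    rw [hx, ENNReal.top_mul hb] at this
    exact absurd this (by simp)
  have hvf : ∀ x, v x ≠ ⊤ := fun x hx => by
    have := h a x
    rw [hx, ENNReal.mul_top ha] at this
    exact absurd this (by simp)
  have hφ := gaussianPDFReal_nonneg 0 1
  have hφm := measurable_gaussianPDFReal 0 1
  have hint : ∀ u : ℝ → ENNReal, Measurable u → (∀ x, u x ≠ ⊤) →
      ∫⁻ x, u x ∂gaussianReal 0 1 = ∫⁻ x, ENNReal.ofReal ((u x).toReal * gaussianPDFReal 0 1 x) := by
    intro u hu huf
    rw [gaussianReal_of_var_ne_zero 0 one_ne_zero,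
      lintegral_withDensity_eq_lintegral_mul _ (measurable_gaussianPDF 0 1) hu]
    refine lintegral_congr fun x => ?_
    rw [ENNReal.ofReal_mul ENNReal.toReal_nonneg, ENNReal.ofReal_toReal (huf x), mul_comm]
    rfl
  have hw : ∫⁻ x, ENNReal.ofReal (gaussianPDFReal 0 1 (x / 2)) = 2 := by
    have h1 : ∀ x : ℝ, gaussianPDFReal 0 1 (x / 2) = 2 * gaussianPDFReal 0 4 x := by
      intro x
      have := gaussianPDFReal_inv_mul (μ := 0) (v := 1) (c := 2) two_ne_zero x
      rw [div_eq_inv_mul, this]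
      norm_num
      congr 1
    simp_rw [h1]
    rw [lintegral_congr fun x => ENNReal.ofReal_mul (by norm_num), lintegral_const_mul _
      (measurable_gaussianPDFReal 0 4).ennreal_ofReal, lintegral_gaussianPDFReal_eq_one 0 (by norm_num)]
    simp
  have key := lintegral_mul_lintegral_le (f := fun x => (u x).toReal * gaussianPDFReal 0 1 x)
    (g := fun x => (v x).toReal * gaussianPDFReal 0 1 x) (w := fun x => gaussianPDFReal 0 1 (x / 2))
    (by fun_prop) (by fun_prop) (by fun_prop) (fun x => mul_nonneg ENNReal.toReal_nonneg (hφ x))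
    (fun x => mul_nonneg ENNReal.toReal_nonneg (hφ x)) (fun x => hφ _)
    (W := (√(2 * Real.pi))⁻¹) (fun x => by
      simp only [gaussianPDFReal, NNReal.coe_one, mul_one]
      exact mul_le_of_le_one_right (by positivity) (Real.exp_le_one_iff.2 (by
        rw [neg_div]; exact neg_nonpos.2 (by positivity))))
    (fun x y => by
      have h1 : (u x).toReal * (v y).toReal ≤ Real.exp ((x - y) ^ 2 / 4) := by
        rw [← ENNReal.toReal_mul]
        exact ENNReal.toReal_le_of_le_ofReal (Real.exp_pos _).le (h x y)
      have h2 : gaussianPDFReal 0 1 ((x + y) / 2) ^ 2 =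
          Real.exp ((x - y) ^ 2 / 4) * (gaussianPDFReal 0 1 x * gaussianPDFReal 0 1 y) := by
        simp only [gaussianPDFReal, NNReal.coe_one, mul_one]
        rw [mul_pow, ← Real.exp_nat_mul, mul_mul_mul_comm, ← Real.exp_add, mul_left_comm,
          ← Real.exp_add, sq]
        congr 2
        push_cast
        ring
      rw [h2, mul_mul_mul_comm]
      exact mul_le_mul_of_nonneg_right h1 (mul_nonneg (hφ _) (hφ _)))
  rw [hint u hu huf, hint v hv hvf]
  rw [hw] at key
  norm_num at key
  simpa using (ENNReal.mul_le_mul_iff_right (a := 4) (by norm_num) (by norm_num)).1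
    (key.trans_eq (mul_one 4).symm)

theorem lintegral_mul_lintegral_pi_fin_le (n : ℕ) {u v : (Fin n → ℝ) → ENNReal} (hu : Measurable u)
    (hv : Measurable v)
    (h : ∀ x y, u x * v y ≤ ENNReal.ofReal (Real.exp ((∑ i, (x i - y i) ^ 2) / 4))) :
    (∫⁻ x, u x ∂Measure.pi fun _ => gaussianReal 0 1) *
      ∫⁻ x, v x ∂(Measure.pi fun _ => gaussianReal 0 1) ≤ 1 := by
  induction n with
  | zero =>
    simp only [lintegral_unique, measure_univ, mul_one]
    exact (h _ _).trans_eq (by simp)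
  | succ n ih =>
    have mp := (measurePreserving_piFinSuccAbove (n := n) (fun _ => gaussianReal 0 1) 0).symm
    have key : ∀ u : (Fin (n + 1) → ℝ) → ENNReal, Measurable u →
        ∫⁻ x, u x ∂(Measure.pi fun _ => gaussianReal 0 1) =
          ∫⁻ a, ∫⁻ x, u (Fin.cons a x) ∂(Measure.pi fun _ => gaussianReal 0 1)
            ∂gaussianReal 0 1 := by
      intro u hu
      rw [← mp.lintegral_comp hu, lintegral_prod _ (by fun_prop)]
      simp [MeasurableEquiv.piFinSuccAbove, Fin.insertNthEquiv]
    have hcons : Measurable fun q : ℝ × (Fin n → ℝ) => (Fin.cons q.1 q.2 : Fin (n + 1) → ℝ) := by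
      refine measurable_pi_lambda _ fun i => ?_
      refine Fin.cases ?_ (fun j => ?_) i
      · simpa using measurable_fst
      · simpa [Function.comp_def] using (measurable_pi_apply j).comp measurable_snd
    rw [key u hu, key v hv]
    refine lintegral_mul_lintegral_gaussianReal_le
      (Measurable.lintegral_prod_right' (hu.comp hcons))
      (Measurable.lintegral_prod_right' (hv.comp hcons)) fun a b => ?_
    have hE : 0 < Real.exp ((a - b) ^ 2 / 4) := Real.exp_pos _
    set c := ENNReal.ofReal (Real.exp ((a - b) ^ 2 / 4)) with hc
    have hc0 : c ≠ 0 := by simpa [hc] using hE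
    have hct : c ≠ ⊤ := by simp [hc]
    have hu' : Measurable fun x => u (Fin.cons a x) := hu.comp (hcons.comp measurable_prodMk_left)
    have hv' : Measurable fun x => v (Fin.cons b x) := hv.comp (hcons.comp measurable_prodMk_left)
    -- Tensorisation: dividing out the cost of the first coordinates leaves the hypothesis in n
    -- variables, and the resulting partial integrals satisfy the one-dimensional hypothesis.
    have := ih (u := fun x => c⁻¹ * u (Fin.cons a x)) (v := fun x => v (Fin.cons b x))
      (hu'.const_mul _) hv' (fun x y => by
        rw [mul_assoc]
        rw [ENNReal.inv_mul_le_iff hc0 hct, hc, ← ENNReal.ofReal_mul hE.le, ← Real.exp_add]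
        refine (h _ _).trans_eq ?_
        rw [Fin.sum_univ_succ]
        simp [add_div])
    rw [lintegral_const_mul _ hu', mul_assoc, ENNReal.inv_mul_le_iff hc0 hct, mul_one] at this
    exact this

theorem lintegral_mul_lintegral_pi_le {ι : Type*} [Fintype ι] {u v : (ι → ℝ) → ENNReal}
    (hu : Measurable u) (hv : Measurable v)
    (h : ∀ x y, u x * v y ≤ ENNReal.ofReal (Real.exp ((∑ i, (x i - y i) ^ 2) / 4))) :
    (∫⁻ x, u x ∂Measure.pi fun _ => gaussianReal 0 1) *
      ∫⁻ x, v x ∂(Measure.pi fun _ => gaussianReal 0 1) ≤ 1 := by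
  have mp := measurePreserving_piCongrLeft (fun _ : ι => gaussianReal 0 1)
    (Fintype.equivFin ι).symm
  rw [← mp.lintegral_comp hu, ← mp.lintegral_comp hv]
  refine lintegral_mul_lintegral_pi_fin_le _ (hu.comp mp.measurable) (hv.comp mp.measurable)
    fun x y => (h _ _).trans_eq ?_
  rw [← (Fintype.equivFin ι).symm.sum_comp]
  simp [MeasurableEquiv.coe_piCongrLeft, Equiv.piCongrLeft_apply_apply]

/-- Gaussian isoperimetry: two sets at Euclidean distance at least `√d` from one another cannot
both have large Gaussian measure. -/
theorem gaussian_mul_le_exp_neg {ι : Type*} [Fintype ι] {A B : Set (ι → ℝ)} {d : ℝ}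
    (hA : MeasurableSet A) (hB : MeasurableSet B)
    (h : ∀ x ∈ A, ∀ y ∈ B, d ≤ ∑ i, (x i - y i) ^ 2) :
    (Measure.pi fun _ => gaussianReal 0 1).real A * (Measure.pi fun _ => gaussianReal 0 1).real B ≤
      Real.exp (-d / 4) := by
  have key := lintegral_mul_lintegral_pi_le (u := A.indicator fun _ => ENNReal.ofReal
    (Real.exp (d / 4))) (v := B.indicator fun _ => 1) (measurable_const.indicator hA)
    (measurable_const.indicator hB) (fun x y => by
      by_cases hx : x ∈ A
      · by_cases hy : y ∈ B
        · simp only [hx, hy, Set.indicator_of_mem, mul_one]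
          gcongr
          exact h x hx y hy
        · simp [hy]
      · simp [hx])
  rw [lintegral_indicator_const hA, lintegral_indicator_const hB, one_mul] at key
  have := ENNReal.toReal_mono ENNReal.one_ne_top key
  rw [ENNReal.toReal_mul, ENNReal.toReal_mul, ENNReal.toReal_ofReal (Real.exp_pos _).le,
    ENNReal.toReal_one] at this
  rw [neg_div, Real.exp_neg, ← one_div, le_div_iff₀ (Real.exp_pos _)]
  simp only [Measure.real]
  linarith

/-! ### The energies as a Gaussian process: covariance, exponential moments, Lipschitz bound. -/

variable {n p : ℕ}

theorem spin_mul_self (σ : Config n) (i : Fin n) : spin σ i * spin σ i = 1 := by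
  rcases Int.units_eq_one_or (σ i) with h | h <;> simp [spin, h]

theorem spin_mul (σ τ : Config n) (i : Fin n) : spin (σ * τ) i = spin σ i * spin τ i := by
  simp [spin]

theorem overlap_self (hn : n ≠ 0) (σ : Config n) : overlap σ σ = 1 := by
  simp [overlap, spin_mul_self, hn]

theorem overlap_mul_left (ε σ τ : Config n) : overlap (ε * σ) (ε * τ) = overlap σ τ := by
  simp only [overlap, spin_mul, mul_mul_mul_comm, spin_mul_self, one_mul]

theorem overlap_comm (σ τ : Config n) : overlap σ τ = overlap τ σ := by
  simp only [overlap, mul_comm]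

/-- The sum over multi-indices factorises into the p-th power of ⟨σ, τ⟩; this is the covariance of
the energies before normalisation. -/
theorem sum_prod_spin_mul (σ τ : Config n) :
    ∑ i : Fin p → Fin n, (∏ k, spin σ (i k)) * ∏ k, spin τ (i k) =
      (n : ℝ) ^ p * overlap σ τ ^ p := by
  rcases eq_or_ne n 0 with rfl | hn
  · rcases eq_or_ne p 0 with rfl | hp
    · simp
    · have : IsEmpty (Fin p → Fin 0) := ⟨fun f => (f ⟨0, Nat.pos_of_ne_zero hp⟩).elim0⟩
      simp [hp]
  · rw [← mul_pow, overlap, mul_inv_cancel_left₀ (by exact_mod_cast hn), Fintype.sum_pow]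
    simp_rw [Finset.prod_mul_distrib]

theorem rpow_normalization_sq (hn : n ≠ 0) (p : ℕ) :
    ((n : ℝ) ^ (-((p : ℝ) + 1) / 2)) ^ 2 * ((n : ℝ) * (n : ℝ) ^ p) = 1 := by
  have h : (0 : ℝ) < n := by exact_mod_cast Nat.pos_of_ne_zero hn
  rw [← Real.rpow_natCast, ← Real.rpow_mul h.le, ← pow_succ', ← Real.rpow_natCast (n : ℝ) (p + 1),
    ← Real.rpow_add h]
  push_cast
  rw [show -((p : ℝ) + 1) / 2 * 2 + (p + 1) = 0 by ring, Real.rpow_zero]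

theorem integrable_exp_sum_pi_gaussianReal {ι : Type*} [Fintype ι] (w : ι → ℝ) :
    Integrable (fun x : ι → ℝ => Real.exp (∑ i, w i * x i))
      (Measure.pi fun _ => gaussianReal 0 1) := by
  simp_rw [Real.exp_sum]
  exact Integrable.fintype_prod fun i => integrable_exp_mul_gaussianReal (w i)

theorem integral_exp_sum_pi_gaussianReal {ι : Type*} [Fintype ι] (w : ι → ℝ) :
    ∫ x : ι → ℝ, Real.exp (∑ i, w i * x i) ∂(Measure.pi fun _ => gaussianReal 0 1) =
      Real.exp ((∑ i, w i ^ 2) / 2) := by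
  simp_rw [Real.exp_sum]
  rw [integral_fintype_prod_eq_prod (f := fun i x => Real.exp (w i * x)), Finset.sum_div,
    Real.exp_sum]
  refine Finset.prod_congr rfl fun i _ => ?_
  have := congrFun (mgf_fun_id_gaussianReal (μ := 0) (v := 1)) (w i)
  simpa [mgf] using this

theorem sum_mul_hamiltonian {ι : Type*} [Fintype ι] (J : Disorder n p) (σ : ι → Config n)
    (θ : ι → ℝ) :
    ∑ t, θ t * hamiltonian J (σ t) = ∑ i : Fin p → Fin n,
      ((n : ℝ) ^ (-((p : ℝ) + 1) / 2) * ∑ t, θ t * ∏ k, spin (σ t) (i k)) * J i := by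
  simp only [hamiltonian, Finset.mul_sum, Finset.sum_mul]
  rw [Finset.sum_comm]
  refine Finset.sum_congr rfl fun i _ => Finset.sum_congr rfl fun t _ => by ring

theorem integrable_exp_sum_hamiltonian {ι : Type*} [Fintype ι] (σ : ι → Config n) (θ : ι → ℝ) :
    Integrable (fun J : Disorder n p => Real.exp (∑ t, θ t * hamiltonian J (σ t)))
      (disorderLaw n p) := by
  simp_rw [sum_mul_hamiltonian]
  exact integrable_exp_sum_pi_gaussianReal _

/-- The joint moment generating function of the energies of finitely many configurations. -/
theorem integral_exp_sum_hamiltonian {ι : Type*} [Fintype ι] (hn : n ≠ 0) (σ : ι → Config n)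
    (θ : ι → ℝ) :
    ∫ J : Disorder n p, Real.exp (∑ t, n * θ t * hamiltonian J (σ t)) ∂disorderLaw n p =
      Real.exp (n * (∑ t, ∑ l, θ t * θ l * overlap (σ t) (σ l) ^ p) / 2) := by
  simp_rw [sum_mul_hamiltonian]
  rw [disorderLaw, integral_exp_sum_pi_gaussianReal]
  congr 2
  simp_rw [mul_pow]
  rw [← Finset.mul_sum]
  set c := (n : ℝ) ^ (-((p : ℝ) + 1) / 2) with hc
  have h1 : ∑ i : Fin p → Fin n, (∑ t, n * θ t * ∏ k, spin (σ t) (i k)) ^ 2 =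
      n ^ 2 * (n : ℝ) ^ p * ∑ t, ∑ l, θ t * θ l * overlap (σ t) (σ l) ^ p := by
    simp_rw [sq (∑ t, _), Finset.sum_mul_sum]
    rw [Finset.sum_comm, Finset.mul_sum]
    refine Finset.sum_congr rfl fun t _ => ?_
    rw [Finset.sum_comm, Finset.mul_sum]
    refine Finset.sum_congr rfl fun l _ => ?_
    rw [show (n : ℝ) ^ 2 * (n : ℝ) ^ p * (θ t * θ l * overlap (σ t) (σ l) ^ p) =
      (n ^ 2 * θ t * θ l) * ((n : ℝ) ^ p * overlap (σ t) (σ l) ^ p) by ring,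
      ← sum_prod_spin_mul, Finset.mul_sum]
    exact Finset.sum_congr rfl fun i _ => by ring
  rw [h1]
  have h2 := rpow_normalization_sq hn p
  rw [← hc] at h2
  linear_combination (n * ∑ t, ∑ l, θ t * θ l * overlap (σ t) (σ l) ^ p) * h2

/-- Cauchy–Schwarz against the rank-one tensor of σ, whose squared norm n^p is reduced to 1/n by the
normalisation. -/
theorem sq_hamiltonian_sub_le (hn : n ≠ 0) (J J' : Disorder n p) (σ : Config n) :
    n * (hamiltonian J σ - hamiltonian J' σ) ^ 2 ≤ ∑ i, (J i - J' i) ^ 2 := by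
  set c := (n : ℝ) ^ (-((p : ℝ) + 1) / 2) with hc
  have h2 := rpow_normalization_sq hn p
  rw [← hc] at h2
  have h1 : hamiltonian J σ - hamiltonian J' σ = c * ∑ i, (J i - J' i) * ∏ k, spin σ (i k) := by
    simp only [hamiltonian, ← hc, sub_mul, Finset.sum_sub_distrib]
    ring
  have h3 : ∑ i : Fin p → Fin n, (∏ k, spin σ (i k)) ^ 2 = (n : ℝ) ^ p := by
    simp_rw [sq]
    rw [sum_prod_spin_mul, overlap_self hn, one_pow, mul_one]
  have h4 := Finset.sum_mul_sq_le_sq_mul_sq Finset.univ (fun i => J i - J' i)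
    fun i => ∏ k, spin σ (i k)
  rw [h3] at h4
  rw [h1, mul_pow]
  calc n * (c ^ 2 * (∑ i, (J i - J' i) * ∏ k, spin σ (i k)) ^ 2)
      ≤ n * (c ^ 2 * ((∑ i, (J i - J' i) ^ 2) * (n : ℝ) ^ p)) := by gcongr
    _ = ∑ i, (J i - J' i) ^ 2 := by linear_combination (∑ i, (J i - J' i) ^ 2) * h2

theorem measurable_hamiltonian (σ : Config n) :
    Measurable fun J : Disorder n p => hamiltonian J σ := by
  unfold hamiltonian
  fun_prop

instance : IsProbabilityMeasure (disorderLaw n p) := by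
  unfold disorderLaw
  infer_instance

/-! ### Joint upper tails of the energies. -/

theorem measurableSet_forall_le_hamiltonian {ι : Type*} [Fintype ι] (c : ℝ) (σ : ι → Config n) :
    MeasurableSet {J : Disorder n p | ∀ t, c ≤ hamiltonian J (σ t)} := by
  rw [Set.ofPred_forall]
  exact MeasurableSet.iInter fun t => measurableSet_le measurable_const (measurable_hamiltonian _)

/-- Chernoff bound for the joint upper tail of the energies. -/
theorem measureReal_forall_le_hamiltonian_le {ι : Type*} [Fintype ι] (hn : n ≠ 0) {c : ℝ}
    (hc : 0 ≤ c) (σ : ι → Config n) :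
    (disorderLaw n p).real {J | ∀ t, c ≤ hamiltonian J (σ t)} ≤
      Real.exp (n * c ^ 2 / 2 * ((∑ t, ∑ l, overlap (σ t) (σ l) ^ p) - 2 * Fintype.card ι)) := by
  have hint := integrable_exp_sum_hamiltonian (p := p) σ fun _ => n * c
  have hval := integral_exp_sum_hamiltonian (p := p) hn σ fun _ => c
  rw [← integral_indicator_one (measurableSet_forall_le_hamiltonian c σ)]
  calc ∫ J, {J : Disorder n p | ∀ t, c ≤ hamiltonian J (σ t)}.indicator 1 J ∂disorderLaw n p
      ≤ ∫ J, Real.exp (-(n * c ^ 2 * Fintype.card ι)) *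
          Real.exp (∑ t, n * c * hamiltonian J (σ t)) ∂disorderLaw n p := by
        refine integral_mono ((integrable_const (1 : ℝ)).indicator
          (measurableSet_forall_le_hamiltonian c σ)) (hint.const_mul _) fun J => ?_
        by_cases hJ : ∀ t, c ≤ hamiltonian J (σ t)
        · simp only [Set.indicator, Set.mem_ofPred_eq, hJ, implies_true, if_true, Pi.one_apply]
          rw [← Real.exp_add, Real.one_le_exp_iff]
          have : ∑ t : ι, n * c * c ≤ ∑ t, n * c * hamiltonian J (σ t) :=
            Finset.sum_le_sum fun t _ => mul_le_mul_of_nonneg_left (hJ t) (by positivity)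
          rw [Finset.sum_const, nsmul_eq_mul, Finset.card_univ] at this
          linarith
        · simp only [Set.indicator, Set.mem_ofPred_eq, hJ, if_false]
          positivity
    _ = _ := by
        rw [integral_const_mul, hval, ← Real.exp_add]
        congr 1
        simp_rw [mul_assoc c c, ← Finset.mul_sum]
        ring

/-- Lower bound for the joint upper tail of positively correlated energies. -/
theorem le_measureReal_forall_le_hamiltonian {ι : Type*} [Fintype ι] (hn : n ≠ 0) {c κ : ℝ}
    (hc : 0 ≤ c) (hκ : 0 ≤ κ) (σ : ι → Config n)
    (hσ : ∀ t l, 0 ≤ overlap (σ t) (σ l)) {G : ℝ}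
    (hG : G = ∑ t, ∑ l, overlap (σ t) (σ l) ^ p) :
    Real.exp (-(n * (c + κ) ^ 2 * G * (1 / 2 + κ))) * (1 - Fintype.card ι *
        Real.exp (-(n * κ ^ 2 / 2)) - Real.exp (-(n * (c + κ) ^ 2 * G * κ ^ 2 / 2))) ≤
      (disorderLaw n p).real {J | ∀ t, c ≤ hamiltonian J (σ t)} := by
  classical
  -- Under the tilt by exp L every energy has mean at least b, hence κ above c, while L has mean n
  -- b² G. The level ℓ exceeds that mean by the factor 1 + κ, so both possible failures are rare.
  set b := c + κ with hb
  set ℓ := n * b ^ 2 * G * (1 + κ) with hℓ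
  set L : Disorder n p → ℝ := fun J => ∑ t, n * b * hamiltonian J (σ t) with hL
  have key : ∀ a : ℝ, ∀ d : ι → ℝ,
      (Integrable (fun J => Real.exp (a * L J + ∑ t, n * d t * hamiltonian J (σ t)))
        (disorderLaw n p)) ∧
      ∫ J, Real.exp (a * L J + ∑ t, n * d t * hamiltonian J (σ t)) ∂disorderLaw n p =
        Real.exp (n * (∑ t, ∑ l, (a * b + d t) * (a * b + d l) * overlap (σ t) (σ l) ^ p) / 2) := by
    intro a d
    have h : ∀ J : Disorder n p, a * L J + ∑ t, n * d t * hamiltonian J (σ t) =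
        ∑ t, n * (a * b + d t) * hamiltonian J (σ t) := by
      intro J
      rw [hL, Finset.mul_sum, ← Finset.sum_add_distrib]
      exact Finset.sum_congr rfl fun t _ => by ring
    simp_rw [h]
    exact ⟨integrable_exp_sum_hamiltonian σ _, integral_exp_sum_hamiltonian hn σ _⟩
  have k1 : Integrable (fun J => Real.exp (L J)) (disorderLaw n p) ∧
      ∫ J, Real.exp (L J) ∂disorderLaw n p = Real.exp (n * b ^ 2 * G / 2) := by
    have := key 1 0
    simp only [one_mul, Pi.zero_apply, mul_zero, zero_mul, Finset.sum_const_zero, add_zero] at this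
    refine ⟨this.1, this.2.trans ?_⟩
    simp_rw [← Finset.mul_sum, ← hG]
    congr 1
    ring
  have k2 : Integrable (fun J => Real.exp ((1 + κ) * L J)) (disorderLaw n p) ∧
      ∫ J, Real.exp ((1 + κ) * L J) ∂disorderLaw n p =
        Real.exp (n * b ^ 2 * G * (1 + κ) ^ 2 / 2) := by
    have := key (1 + κ) 0
    simp only [Pi.zero_apply, mul_zero, zero_mul, Finset.sum_const_zero, add_zero] at this
    refine ⟨this.1, this.2.trans ?_⟩
    simp_rw [← Finset.mul_sum, ← hG]
    congr 1
    ring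
  have k3 : ∀ s, Integrable (fun J => Real.exp (L J - n * κ * (hamiltonian J (σ s) - c)))
      (disorderLaw n p) ∧
      ∫ J, Real.exp (L J - n * κ * (hamiltonian J (σ s) - c)) ∂disorderLaw n p ≤
        Real.exp (n * b ^ 2 * G / 2) * Real.exp (-(n * κ ^ 2 / 2)) := by
    intro s
    have := key 1 fun t => if t = s then -κ else 0
    have h : ∀ J : Disorder n p, Real.exp (L J - n * κ * (hamiltonian J (σ s) - c)) =
        Real.exp (n * κ * c) * Real.exp (1 * L J +
          ∑ t, n * (if t = s then -κ else 0) * hamiltonian J (σ t)) := by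
      intro J
      rw [← Real.exp_add]
      congr 1
      simp only [mul_ite, ite_mul, mul_zero, zero_mul, Finset.sum_ite_eq', Finset.mem_univ, if_true]
      ring
    simp_rw [h]
    refine ⟨this.1.const_mul _, ?_⟩
    rw [integral_const_mul, this.2, ← Real.exp_add, ← Real.exp_add, Real.exp_le_exp]
    have hs : ∑ t, ∑ l, (1 * b + if t = s then -κ else 0) * (1 * b + if l = s then -κ else 0) *
        overlap (σ t) (σ l) ^ p = b ^ 2 * G - 2 * b * κ * (∑ l, overlap (σ s) (σ l) ^ p)
          + κ ^ 2 := by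
      have e1 : ∀ t l, (1 * b + if t = s then -κ else 0) * (1 * b + if l = s then -κ else 0) *
          overlap (σ t) (σ l) ^ p = b ^ 2 * overlap (σ t) (σ l) ^ p
            - b * κ * (if t = s then overlap (σ t) (σ l) ^ p else 0)
            - b * κ * (if l = s then overlap (σ t) (σ l) ^ p else 0)
            + κ ^ 2 * (if t = s then if l = s then overlap (σ t) (σ l) ^ p else 0 else 0) := by
        intro t l
        split_ifs <;> ring
      simp_rw [e1, Finset.sum_add_distrib, Finset.sum_sub_distrib, ← Finset.mul_sum, ← hG]
      have e2 : ∑ t, ∑ l, (if t = s then overlap (σ t) (σ l) ^ p else 0) =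
          ∑ l, overlap (σ s) (σ l) ^ p := by
        rw [Finset.sum_comm]
        simp
      have e3 : ∑ t, ∑ l, (if l = s then overlap (σ t) (σ l) ^ p else 0) =
          ∑ l, overlap (σ s) (σ l) ^ p := by
        simp [overlap_comm _ (σ s)]
      have e4 : ∑ t, ∑ l, (if t = s then if l = s then overlap (σ t) (σ l) ^ p else 0 else 0)
          = 1 := by
        rw [Finset.sum_comm]
        simp [overlap_self hn]
      rw [e2, e3, e4]
      ring
    rw [hs]
    have h1 : 1 ≤ ∑ l, overlap (σ s) (σ l) ^ p := by
      have := Finset.single_le_sum (f := fun l => overlap (σ s) (σ l) ^ p)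
        (fun l _ => pow_nonneg (hσ s l) p) (Finset.mem_univ s)
      simpa [overlap_self hn] using this
    have h2 : n * (b * κ) * 1 ≤ n * (b * κ) * ∑ l, overlap (σ s) (σ l) ^ p :=
      mul_le_mul_of_nonneg_left h1 (by positivity)
    have h3 : n * κ * c = n * (b * κ) - n * κ ^ 2 := by rw [hb]; ring
    linarith
  -- A tilting argument made pointwise: if L > ℓ the last term outweighs exp L, if some energy is
  -- below c its summand does, and otherwise exp(L - ℓ) ≤ 1.
  have hpt : ∀ J : Disorder n p, Real.exp (-ℓ) * (Real.exp (L J)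
      - ∑ s, Real.exp (L J - n * κ * (hamiltonian J (σ s) - c))
      - Real.exp (-(κ * ℓ)) * Real.exp ((1 + κ) * L J)) ≤
      {J : Disorder n p | ∀ t, c ≤ hamiltonian J (σ t)}.indicator 1 J := by
    intro J
    have hsum : 0 ≤ ∑ s, Real.exp (L J - n * κ * (hamiltonian J (σ s) - c)) :=
      Finset.sum_nonneg fun s _ => (Real.exp_pos _).le
    have hpos : 0 ≤ Real.exp (-(κ * ℓ)) * Real.exp ((1 + κ) * L J) := by positivity
    have hnn : (0 : ℝ) ≤ {J : Disorder n p | ∀ t, c ≤ hamiltonian J (σ t)}.indicator 1 J :=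
      Set.indicator_nonneg (fun _ _ => zero_le_one) _
    by_cases hlt : ℓ < L J
    · refine le_trans (mul_nonpos_of_nonneg_of_nonpos (Real.exp_pos _).le ?_) hnn
      have : Real.exp (L J) ≤ Real.exp (-(κ * ℓ)) * Real.exp ((1 + κ) * L J) := by
        rw [← Real.exp_add, Real.exp_le_exp]
        nlinarith
      linarith
    by_cases hJ : ∀ t, c ≤ hamiltonian J (σ t)
    · simp only [Set.indicator, Set.mem_ofPred_eq, hJ, implies_true, if_true, Pi.one_apply]
      calc _ ≤ Real.exp (-ℓ) * Real.exp (L J) := by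
            refine mul_le_mul_of_nonneg_left ?_ (Real.exp_pos _).le
            linarith
        _ ≤ 1 := by
            rw [← Real.exp_add, Real.exp_le_one_iff]
            linarith
    · refine le_trans (mul_nonpos_of_nonneg_of_nonpos (Real.exp_pos _).le ?_) hnn
      push Not at hJ
      obtain ⟨s, hs⟩ := hJ
      have h1 : Real.exp (L J) ≤ Real.exp (L J - n * κ * (hamiltonian J (σ s) - c)) := by
        rw [Real.exp_le_exp]
        have : (0 : ℝ) ≤ n * κ := by positivity
        nlinarith
      have h2 := Finset.single_le_sum
        (f := fun s => Real.exp (L J - n * κ * (hamiltonian J (σ s) - c)))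
        (fun s _ => (Real.exp_pos _).le) (Finset.mem_univ s)
      linarith
  rw [← integral_indicator_one (measurableSet_forall_le_hamiltonian c σ)]
  have i3 : Integrable (fun J => ∑ s, Real.exp (L J - n * κ * (hamiltonian J (σ s) - c)))
      (disorderLaw n p) := integrable_finsetSum _ fun s _ => (k3 s).1
  have i4 : Integrable (fun J => Real.exp (L J) -
      ∑ s, Real.exp (L J - n * κ * (hamiltonian J (σ s) - c))) (disorderLaw n p) := k1.1.sub i3
  refine le_trans ?_ (integral_mono ((i4.sub (k2.1.const_mul _)).const_mul _)
    ((integrable_const (1 : ℝ)).indicator (measurableSet_forall_le_hamiltonian c σ)) hpt)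
  simp only [Pi.sub_apply]
  rw [integral_const_mul, integral_sub i4 (k2.1.const_mul _), integral_const_mul,
    integral_sub k1.1 i3, integral_finsetSum _ fun s _ => (k3 s).1, k1.2, k2.2]
  have hS : ∑ s, ∫ J, Real.exp (L J - n * κ * (hamiltonian J (σ s) - c)) ∂disorderLaw n p ≤
      Fintype.card ι * (Real.exp (n * b ^ 2 * G / 2) * Real.exp (-(n * κ ^ 2 / 2))) := by
    refine (Finset.sum_le_sum fun s _ => (k3 s).2).trans_eq ?_
    rw [Finset.sum_const, nsmul_eq_mul, Finset.card_univ]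
  have e1 : Real.exp (-(n * b ^ 2 * G * (1 / 2 + κ))) =
      Real.exp (-ℓ) * Real.exp (n * b ^ 2 * G / 2) := by
    rw [← Real.exp_add, hℓ]
    congr 1
    ring
  have e2 : Real.exp (-(κ * ℓ)) * Real.exp (n * b ^ 2 * G * (1 + κ) ^ 2 / 2) =
      Real.exp (n * b ^ 2 * G / 2) * Real.exp (-(n * b ^ 2 * G * κ ^ 2 / 2)) := by
    rw [← Real.exp_add, ← Real.exp_add, hℓ]
    congr 1
    ring
  rw [e1, e2, mul_assoc]
  refine mul_le_mul_of_nonneg_left ?_ (Real.exp_pos _).le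
  linarith

/-! ### Combinatorics of the cube: small caps and tuples with prescribed overlaps. -/

theorem overlap_neg_right (σ τ : Config n) : overlap σ (-τ) = -overlap σ τ := by
  simp [overlap, spin]

/-- Turns strong correlation between two gauge copies into membership of ε' in a cap, so that such
ε' can be counted. -/
theorem overlap_mul_mul (ε ε' σ τ : Config n) :
    overlap (ε * σ) (ε' * τ) = overlap ε' (ε * σ * τ) := by
  simp only [overlap, spin_mul]
  congr 1
  exact Finset.sum_congr rfl fun i _ => by ring

theorem sum_exp_mul_spin (l : ℝ) (σ : Config n) :
    ∑ ε : Config n, Real.exp (l * ∑ i, spin ε i * spin σ i) =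
      (Real.exp l + Real.exp (-l)) ^ n := by
  have h : ∀ i, ∑ u : ℤˣ, Real.exp (l * (((u : ℤ) : ℝ) * spin σ i)) =
      Real.exp l + Real.exp (-l) := by
    intro i
    rw [show (Finset.univ : Finset ℤˣ) = {1, -1} from rfl, Finset.sum_pair (by decide)]
    rcases Int.units_eq_one_or (σ i) with h | h <;> simp [spin, h, add_comm]
  calc ∑ ε : Config n, Real.exp (l * ∑ i, spin ε i * spin σ i)
      = ∑ ε : Config n, ∏ i, Real.exp (l * (((ε i : ℤ) : ℝ) * spin σ i)) := by
        refine Finset.sum_congr rfl fun ε _ => ?_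
        rw [Finset.mul_sum, Real.exp_sum]
        rfl
    _ = ∏ i : Fin n, ∑ u : ℤˣ, Real.exp (l * (((u : ℤ) : ℝ) * spin σ i)) := by
        rw [Finset.prod_univ_sum, Fintype.piFinset_univ]
    _ = _ := by
        simp_rw [h]
        simp

open Classical in
theorem card_lt_overlap_le {l δ : ℝ} (hl : 0 ≤ l) (σ : Config n) :
    (Finset.card {ε : Config n | 1 - δ < overlap ε σ} : ℝ) ≤
      (Real.exp (l * δ) * (1 + Real.exp (-(2 * l)))) ^ n := by
  have h1 : Real.exp (l * δ) * (1 + Real.exp (-(2 * l))) =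
      Real.exp (-(l * (1 - δ))) * (Real.exp l + Real.exp (-l)) := by
    rw [mul_add, mul_add, ← Real.exp_add, ← Real.exp_add, ← Real.exp_add, mul_one]
    congr 2 <;> ring
  rw [h1, mul_pow, ← sum_exp_mul_spin l σ, Finset.mul_sum, ← Real.exp_nat_mul]
  rw [← nsmul_one, ← Finset.sum_const]
  refine (Finset.sum_le_sum fun ε hε => ?_).trans
    (Finset.sum_le_univ_sum_of_nonneg fun ε => by positivity)
  rw [← Real.exp_add, Real.one_le_exp_iff]
  have hε : 1 - δ < overlap ε σ := by simpa using hε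
  have hs : ∑ i, spin ε i * spin σ i = n * overlap ε σ := by
    rcases eq_or_ne n 0 with rfl | hn
    · simp
    · rw [overlap, mul_inv_cancel_left₀ (by exact_mod_cast hn)]
  rw [hs]
  have : (n : ℝ) * l * (1 - δ) ≤ n * l * overlap ε σ :=
    mul_le_mul_of_nonneg_left hε.le (by positivity)
  linarith

open Classical in
/-- Hamming balls of small radius, together with their antipodes, have subexponential size. -/
theorem exists_card_lt_abs_overlap_le {h : ℝ} (hh : 0 < h) :
    ∃ δ : ℝ, 0 < δ ∧ δ < 1 ∧ ∀ (n : ℕ) (σ : Config n),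
      (Finset.card {ε : Config n | 1 - δ < |overlap ε σ|} : ℝ) ≤ 2 * Real.exp (h * n) := by
  -- In the Chernoff bound, first l is taken large to make e^(-2l) small, then δ small enough that
  -- lδ ≤ h/2.
  obtain ⟨l, hl, hl2⟩ : ∃ l : ℝ, 0 < l ∧ Real.exp (-(2 * l)) < h / 2 := by
    have ht : Tendsto (fun l : ℝ => Real.exp (-(2 * l))) atTop (𝓝 0) :=
      Real.tendsto_exp_neg_atTop_nhds_zero.comp (tendsto_id.const_mul_atTop two_pos)
    exact ((eventually_gt_atTop 0).and (ht.eventually_lt_const (half_pos hh))).exists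
  refine ⟨min (1 / 2) (h / (2 * l)), by positivity, by
    linarith [min_le_left (1 / 2) (h / (2 * l))], fun n σ => ?_⟩
  set δ := min (1 / 2) (h / (2 * l)) with hδ
  have hlδ : l * δ ≤ h / 2 := by
    calc l * δ ≤ l * (h / (2 * l)) := mul_le_mul_of_nonneg_left (min_le_right _ _) hl.le
      _ = h / 2 := by field_simp
  have hle : Real.exp (l * δ) * (1 + Real.exp (-(2 * l))) ≤ Real.exp h := by
    calc _ ≤ Real.exp (h / 2) * Real.exp (h / 2) := by
          gcongr
          linarith [Real.add_one_le_exp (h / 2)]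
      _ = Real.exp h := by rw [← Real.exp_add, add_halves]
  have hone : ∀ σ : Config n, (Finset.card {ε : Config n | 1 - δ < overlap ε σ} : ℝ) ≤
      Real.exp (h * n) := by
    intro σ
    refine (card_lt_overlap_le hl.le σ).trans ?_
    rw [mul_comm h, Real.exp_nat_mul]
    gcongr
  have hsub : ({ε : Config n | 1 - δ < |overlap ε σ|} : Finset (Config n)) ⊆
      ({ε : Config n | 1 - δ < overlap ε σ} : Finset (Config n)) ∪
        ({ε : Config n | 1 - δ < overlap ε (-σ)} : Finset (Config n)) := by
    intro ε
    simp [overlap_neg_right, lt_abs]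
  calc (Finset.card {ε : Config n | 1 - δ < |overlap ε σ|} : ℝ)
      ≤ (Finset.card {ε : Config n | 1 - δ < overlap ε σ} : ℝ) +
        (Finset.card {ε : Config n | 1 - δ < overlap ε (-σ)} : ℝ) := by
        exact_mod_cast (Finset.card_le_card hsub).trans (Finset.card_union_le _ _)
    _ ≤ 2 * Real.exp (h * n) := by linarith [hone σ, hone (-σ)]

theorem sum_units_pi_mul_eq_zero {ι : Type*} [Fintype ι] [DecidableEq ι] {t l : ι} (htl : t ≠ l) :
    ∑ s : ι → ℤˣ, ((s t : ℤ) : ℝ) * ((s l : ℤ) : ℝ) = 0 := by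
  -- Flipping the sign at t permutes the sign patterns and negates the summand.
  have h := Equiv.sum_comp (Equiv.mulLeft (Pi.mulSingle t (-1) : ι → ℤˣ))
    fun s : ι → ℤˣ => ((s t : ℤ) : ℝ) * ((s l : ℤ) : ℝ)
  simp [Pi.mulSingle_eq_of_ne htl.symm] at h
  linarith

/-- All members agree on k sites; the other sites carry q copies of every sign pattern in {±1}^m,
whose contributions to distinct pairs cancel. -/
theorem exists_overlap_eq {m k q : ℕ} (hn : n = k + q * 2 ^ m) :
    ∃ σ : Fin m → Config n, ∀ t l, t ≠ l → overlap (σ t) (σ l) = (n : ℝ)⁻¹ * k := by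
  have e : Fin n ≃ Fin k ⊕ Fin q × (Fin m → ℤˣ) := Fintype.equivOfCardEq (by simp [hn])
  refine ⟨fun t i => Sum.elim (fun _ => 1) (fun x => x.2 t) (e i), fun t l htl => ?_⟩
  simp only [overlap, spin]
  congr 1
  rw [e.sum_comp fun x => (((Sum.elim (fun _ => 1) (fun x => x.2 t) x : ℤˣ) : ℤ) : ℝ) *
    (((Sum.elim (fun _ => 1) (fun x => x.2 l) x : ℤˣ) : ℤ) : ℝ)]
  simp [Fintype.sum_sum_type, Fintype.sum_prod_type, sum_units_pi_mul_eq_zero htl]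

theorem eventually_exists_overlap_mem_Icc (m : ℕ) {ξ η : ℝ} (hη : 0 < η) (hηξ : η < ξ)
    (hξ : ξ < 1) :
    ∀ᶠ n : ℕ in atTop, ∃ σ : Fin m → Config n, ∀ t l, t ≠ l →
      overlap (σ t) (σ l) ∈ Set.Icc (ξ - η) ξ := by
  filter_upwards [eventually_gt_atTop 0, eventually_ge_atTop ⌈2 ^ m / η⌉₊] with n hn0 hn
  have hn' : (0 : ℝ) < n := by exact_mod_cast hn0
  have hηn : 2 ^ m ≤ η * n := by
    have := (Nat.le_ceil _).trans (Nat.cast_le (α := ℝ).2 hn)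
    rw [div_le_iff₀ hη] at this
    linarith
  -- Rounding up keeps the overlap at most ξ and loses at most 2^m / n ≤ η.
  set q := ⌈(n : ℝ) * (1 - ξ) / 2 ^ m⌉₊ with hq
  have hq0 : (n : ℝ) * (1 - ξ) / 2 ^ m ≤ q := Nat.le_ceil _
  have hq1 : (q : ℝ) < n * (1 - ξ) / 2 ^ m + 1 :=
    Nat.ceil_lt_add_one (div_nonneg (mul_nonneg hn'.le (by linarith)) (by positivity))
  have h2 : (0 : ℝ) < 2 ^ m := by positivity
  rw [div_le_iff₀ h2] at hq0
  rw [div_add_one h2.ne', lt_div_iff₀ h2] at hq1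
  have hqn : q * 2 ^ m ≤ n := by
    have : (q : ℝ) * 2 ^ m ≤ n := by nlinarith
    exact_mod_cast this
  obtain ⟨σ, hσ⟩ := exists_overlap_eq (n := n) (m := m) (k := n - q * 2 ^ m) (q := q) (by omega)
  refine ⟨σ, fun t l htl => ?_⟩
  rw [hσ t l htl, Nat.cast_sub hqn, ← div_eq_inv_mul]
  push_cast
  refine ⟨(le_div_iff₀ hn').2 ?_, (div_le_iff₀ hn').2 ?_⟩ <;> nlinarith

/-! ### Second moment inequality and auxiliary bounds. -/

/-- The second moment method for a finite family of events. -/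
theorem sq_sum_measureReal_le {Ω ι : Type*} [MeasurableSpace Ω] [Fintype ι] (μ : Measure Ω)
    [IsProbabilityMeasure μ] {A : ι → Set Ω} (hA : ∀ i, MeasurableSet (A i)) :
    (∑ i, μ.real (A i)) ^ 2 ≤ μ.real (⋃ i, A i) * ∑ i, ∑ j, μ.real (A i ∩ A j) := by
  set M : Ω → ℝ := fun ω => ∑ i, (A i).indicator 1 ω with hM
  have hI : ∀ s : Set Ω, MeasurableSet s → Integrable (s.indicator (1 : Ω → ℝ)) μ := fun s hs =>
    (integrable_const (1 : ℝ)).indicator hs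
  have hMi : Integrable M μ := integrable_finsetSum _ fun i _ => hI _ (hA i)
  have hM1 : ∫ ω, M ω ∂μ = ∑ i, μ.real (A i) := by
    rw [integral_finsetSum _ fun i _ => hI _ (hA i)]
    exact Finset.sum_congr rfl fun i _ => integral_indicator_one (hA i)
  have hMM : ∀ ω, M ω ^ 2 = ∑ i, ∑ j, (A i ∩ A j).indicator 1 ω := by
    intro ω
    rw [hM, sq, Finset.sum_mul_sum]
    simp_rw [Set.inter_indicator_one, Pi.mul_apply]
  have hMMi : Integrable (fun ω => M ω ^ 2) μ := by
    simp_rw [hMM]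
    exact integrable_finsetSum _ fun i _ => integrable_finsetSum _ fun j _ =>
      hI _ ((hA i).inter (hA j))
  have hM2 : ∫ ω, M ω ^ 2 ∂μ = ∑ i, ∑ j, μ.real (A i ∩ A j) := by
    simp_rw [hMM]
    rw [integral_finsetSum _ fun i _ => integrable_finsetSum _ fun j _ =>
      hI _ ((hA i).inter (hA j))]
    refine Finset.sum_congr rfl fun i _ => ?_
    rw [integral_finsetSum _ fun j _ => hI _ ((hA i).inter (hA j))]
    exact Finset.sum_congr rfl fun j _ => integral_indicator_one ((hA i).inter (hA j))
  have hU : MeasurableSet (⋃ i, A i) := MeasurableSet.iUnion hA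
  -- Integrates 2aM - a²M² ≤ 1 on the union, where M counts the events that occur; the optimal a is
  -- S/T.
  have key : ∀ a : ℝ, a * (2 * ∑ i, μ.real (A i)) - a ^ 2 * ∑ i, ∑ j, μ.real (A i ∩ A j) ≤
      μ.real (⋃ i, A i) := by
    intro a
    rw [← hM1, ← hM2, ← integral_indicator_one hU, ← integral_const_mul, ← integral_const_mul,
      ← integral_const_mul, ← integral_sub ((hMi.const_mul _).const_mul _) (hMMi.const_mul _)]
    refine integral_mono (((hMi.const_mul _).const_mul _).sub (hMMi.const_mul _)) (hI _ hU)
      fun ω => ?_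
    by_cases hω : ω ∈ ⋃ i, A i
    · simp only [hω, Set.indicator_of_mem, Pi.one_apply]
      nlinarith [sq_nonneg (a * M ω - 1)]
    · have : M ω = 0 := Finset.sum_eq_zero fun i _ =>
        Set.indicator_of_notMem (fun h => hω (Set.mem_iUnion.2 ⟨i, h⟩)) _
      simp [hω, this]
  set S := ∑ i, μ.real (A i)
  set T := ∑ i, ∑ j, μ.real (A i ∩ A j)
  have hT : 0 ≤ T := Finset.sum_nonneg fun i _ => Finset.sum_nonneg fun j _ => measureReal_nonneg
  rcases hT.eq_or_lt with hT0 | hT0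
  · rw [← hT0, mul_zero]
    by_contra hS
    push Not at hS
    have h1 := key ((1 / S))
    have hS0 : S ≠ 0 := fun h => by simp [h] at hS
    rw [← hT0, mul_zero, sub_zero, show 1 / S * (2 * S) = 2 by field_simp] at h1
    linarith [measureReal_le_one (μ := μ) (s := ⋃ i, A i)]
  · have h1 := key (S / T)
    rw [show S / T * (2 * S) - (S / T) ^ 2 * T = S ^ 2 / T by field_simp; ring,
      div_le_iff₀ hT0] at h1
    exact h1

theorem sum_overlap_pow_le {ι : Type*} [Fintype ι] (hn : n ≠ 0) (σ : ι → Config n) {r : ℝ}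
    (hσ : ∀ t l, t ≠ l → |overlap (σ t) (σ l)| ≤ r) (hr : 0 ≤ r) (p : ℕ) :
    ∑ t, ∑ l, overlap (σ t) (σ l) ^ p ≤ Fintype.card ι + (Fintype.card ι : ℝ) ^ 2 * r ^ p := by
  classical
  calc ∑ t, ∑ l, overlap (σ t) (σ l) ^ p ≤ ∑ t : ι, ∑ l : ι, ((if t = l then 1 else 0) + r ^ p) := by
        refine Finset.sum_le_sum fun t _ => Finset.sum_le_sum fun l _ => ?_
        by_cases h : t = l
        · have := pow_nonneg hr p
          simp [h, overlap_self hn, this]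
        · rw [if_neg h, zero_add]
          exact (le_abs_self _).trans ((abs_pow _ _).trans_le
            (pow_le_pow_left₀ (abs_nonneg _) (hσ t l h) p))
    _ = _ := by
        simp [Finset.sum_add_distrib]
        ring

theorem measurableSet_solutionTuples_nonempty (γ : ℝ) (m : ℕ) (ξ η : ℝ) :
    MeasurableSet {J : Disorder n p | (solutionTuples J γ m ξ η).Nonempty} := by
  have : {J : Disorder n p | (solutionTuples J γ m ξ η).Nonempty} =
      ⋃ σ : Fin m → Config n, {J : Disorder n p |
        (∀ t, γ * Real.sqrt (2 * Real.log 2) ≤ hamiltonian J (σ t)) ∧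
          ∀ t l : Fin m, t < l → overlap (σ t) (σ l) ∈ Set.Icc (ξ - η) ξ} := by
    ext J
    simp [Set.Nonempty, solutionTuples]
  rw [this]
  exact MeasurableSet.iUnion fun σ => (measurableSet_forall_le_hamiltonian _ σ).inter
    (MeasurableSet.const _)

theorem existenceProb_le_one (n p : ℕ) (γ : ℝ) (m : ℕ) (ξ η : ℝ) :
    existenceProb n p γ m ξ η ≤ 1 := measureReal_le_one

theorem existenceProb_nonneg (n p : ℕ) (γ : ℝ) (m : ℕ) (ξ η : ℝ) :
    0 ≤ existenceProb n p γ m ξ η := measureReal_nonneg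

/-! ### First moment: inadmissibility above 1/√m. -/

open Classical in
theorem card_overlap_mem_Icc_le {k : ℕ} {ξ η δ V : ℝ} (hξ : 1 - δ < ξ - η)
    (hV : ∀ σ : Config n, (Finset.card {ε : Config n | 1 - δ < |overlap ε σ|} : ℝ) ≤ V) :
    (Finset.card {σ : Fin (k + 1) → Config n |
      ∀ t l, t < l → overlap (σ t) (σ l) ∈ Set.Icc (ξ - η) ξ} : ℝ) ≤ 2 ^ n * V ^ k := by
  set B : Config n → Finset (Config n) := fun σ => {ε : Config n | 1 - δ < |overlap ε σ|}
  have hsub : ({σ : Fin (k + 1) → Config n |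
      ∀ t l, t < l → overlap (σ t) (σ l) ∈ Set.Icc (ξ - η) ξ} : Finset (Fin (k + 1) → Config n)) ⊆
      Finset.univ.biUnion fun τ : Config n =>
        (Fintype.piFinset fun _ : Fin k => B τ).image fun ρ => (Fin.cons τ ρ : Fin (k + 1) → _) := by
    intro σ hσ
    simp only [Finset.mem_filter, Finset.mem_univ, true_and] at hσ
    simp only [Finset.mem_biUnion, Finset.mem_univ, true_and, Finset.mem_image,
      Fintype.mem_piFinset]
    refine ⟨σ 0, fun i => σ i.succ, fun i => ?_, Fin.cons_self_tail σ⟩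
    have := (hσ 0 i.succ (Fin.succ_pos i)).1
    rw [overlap_comm] at this
    simp only [B, Finset.mem_filter, Finset.mem_univ, true_and]
    exact hξ.trans_le (this.trans (le_abs_self _))
  have h1 := (Finset.card_le_card hsub).trans Finset.card_biUnion_le
  calc _ ≤ ((∑ τ : Config n, ((Fintype.piFinset fun _ : Fin k => B τ).image fun ρ =>
        (Fin.cons τ ρ : Fin (k + 1) → _)).card : ℕ) : ℝ) := by exact_mod_cast h1
    _ ≤ ∑ τ : Config n, V ^ k := by
        rw [Nat.cast_sum]
        refine Finset.sum_le_sum fun τ _ => ?_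
        have h2 := Finset.card_image_le (s := Fintype.piFinset fun _ : Fin k => B τ)
          (f := fun ρ => (Fin.cons τ ρ : Fin (k + 1) → Config n))
        rw [Fintype.card_piFinset_const] at h2
        refine (Nat.cast_le.2 h2).trans ?_
        push_cast
        exact pow_le_pow_left₀ (Nat.cast_nonneg _) (hV τ) k
    _ = 2 ^ n * V ^ k := by simp

open Classical in
theorem existenceProb_le (hn : n ≠ 0) {k : ℕ} {γ ξ η δ V : ℝ} (hγ : 0 ≤ γ) (hδ : δ ≤ 1)
    (hξ : 1 - δ < ξ - η) (hξ0 : 0 ≤ ξ)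
    (hV : ∀ σ : Config n, (Finset.card {ε : Config n | 1 - δ < |overlap ε σ|} : ℝ) ≤ V) :
    existenceProb n p γ (k + 1) ξ η ≤ 2 ^ n * V ^ k *
      Real.exp (n * (γ ^ 2 * Real.log 2 * (((k : ℝ) + 1) ^ 2 * ξ ^ p - (k + 1)))) := by
  have hl : 0 < Real.log 2 := Real.log_pos one_lt_two
  set c := γ * Real.sqrt (2 * Real.log 2) with hc
  have hc2 : c ^ 2 = 2 * (γ ^ 2 * Real.log 2) := by
    rw [hc, mul_pow, Real.sq_sqrt (by positivity)]; ring
  set F : Finset (Fin (k + 1) → Config n) := {σ : Fin (k + 1) → Config n |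
      ∀ t l, t < l → overlap (σ t) (σ l) ∈ Set.Icc (ξ - η) ξ}
  have hsub : {J : Disorder n p | (solutionTuples J γ (k + 1) ξ η).Nonempty} ⊆
      ⋃ σ ∈ F, {J : Disorder n p | ∀ t, c ≤ hamiltonian J (σ t)} := by
    rintro J ⟨σ, h1, h2⟩
    simp only [Set.mem_iUnion]
    exact ⟨σ, by simpa [F] using h2, h1⟩
  calc existenceProb n p γ (k + 1) ξ η
      ≤ (disorderLaw n p).real (⋃ σ ∈ F, {J : Disorder n p | ∀ t, c ≤ hamiltonian J (σ t)}) :=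
        measureReal_mono hsub (measure_ne_top _ _)
    _ ≤ ∑ σ ∈ F, (disorderLaw n p).real {J : Disorder n p | ∀ t, c ≤ hamiltonian J (σ t)} :=
        measureReal_biUnion_finset_le _ _
    _ ≤ ∑ σ ∈ F, Real.exp (n * (γ ^ 2 * Real.log 2 * (((k : ℝ) + 1) ^ 2 * ξ ^ p - (k + 1)))) := by
        refine Finset.sum_le_sum fun σ hσ => ?_
        refine (measureReal_forall_le_hamiltonian_le hn (by positivity) σ).trans ?_
        rw [Real.exp_le_exp]
        have hσ' : ∀ t l, t < l → overlap (σ t) (σ l) ∈ Set.Icc (ξ - η) ξ := by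
          simpa [F] using hσ
        have habs : ∀ t l, t < l → |overlap (σ t) (σ l)| ≤ ξ := fun t l htl => by
          have := hσ' t l htl
          rw [abs_of_nonneg (by linarith [this.1])]
          exact this.2
        have h := sum_overlap_pow_le hn σ (r := ξ) (fun t l htl => by
          rcases htl.lt_or_gt with h | h
          · exact habs t l h
          · rw [overlap_comm]; exact habs l t h) hξ0 p
        rw [Fintype.card_fin] at h ⊢
        push_cast at h ⊢
        rw [hc2]
        have h0 : 0 ≤ n * (γ ^ 2 * Real.log 2) := by positivity
        nlinarith
    _ = F.card * Real.exp (n * (γ ^ 2 * Real.log 2 * (((k : ℝ) + 1) ^ 2 * ξ ^ p - (k + 1)))) := by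
        rw [Finset.sum_const, nsmul_eq_mul]
    _ ≤ _ := by
        gcongr
        exact card_overlap_mem_Icc_le hξ hV

theorem tendsto_exp_natCast_mul_nhds_zero {a : ℝ} (ha : a < 0) (C : ℝ) :
    Tendsto (fun n : ℕ => C * Real.exp (n * a)) atTop (𝓝 0) := by
  have : Tendsto (fun n : ℕ => Real.exp (n * a)) atTop (𝓝 0) :=
    Real.tendsto_exp_atBot.comp (tendsto_natCast_atTop_atTop.atTop_mul_const_of_neg ha)
  simpa using this.const_mul C

theorem mInadmissible_of_lt {m : ℕ} (hm : 1 ≤ m) {γ : ℝ} (hγ : 1 / Real.sqrt m < γ) :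
    MInadmissible m γ := by
  obtain ⟨k, rfl⟩ : ∃ k, m = k + 1 := ⟨m - 1, by omega⟩
  have hl : 0 < Real.log 2 := Real.log_pos one_lt_two
  have hm0 : (0 : ℝ) < ((k + 1 : ℕ) : ℝ) := by positivity
  have hγ0 : 0 < γ := lt_trans (by positivity) hγ
  have hg : 0 < ((k : ℝ) + 1) * γ ^ 2 - 1 := by
    rw [div_lt_iff₀ (Real.sqrt_pos.2 hm0)] at hγ
    have := Real.sq_sqrt hm0.le
    push_cast at *
    nlinarith [Real.sqrt_nonneg ((k : ℝ) + 1)]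
  set g := ((k : ℝ) + 1) * γ ^ 2 - 1 with hgdef
  -- Of the exponential gap g log 2, one quarter pays for the cap entropy kh and one quarter for the
  -- correlations ξ^p; half remains.
  set h := g * Real.log 2 / (4 * (k + 1)) with hh
  have hh0 : 0 < h := by positivity
  obtain ⟨δ, hδ0, hδ1, hV⟩ := exists_card_lt_abs_overlap_le hh0
  -- With η ≤ δ/4, the whole overlap window stays above 1 - δ/2, inside the small cap.
  set ξ := 1 - δ / 4 with hξ
  have hξ0 : 0 ≤ ξ := by linarith
  have hξ1 : ξ < 1 := by linarith
  obtain ⟨P, hP⟩ := ((tendsto_pow_atTop_nhds_zero_of_lt_one hξ0 hξ1).eventually_lt_const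
    (show 0 < g / (4 * (γ ^ 2 * ((k : ℝ) + 1) ^ 2)) by positivity)).exists_forall_of_atTop
  refine ⟨ξ, δ / 4, by positivity, by linarith, hξ1, P, fun p hp η hη0 hη => ?_⟩
  have hp' := hP p hp
  rw [lt_div_iff₀ (by positivity)] at hp'
  refine squeeze_zero' (.of_forall fun n => existenceProb_nonneg n p γ _ ξ η) ?_
    (tendsto_exp_natCast_mul_nhds_zero (a := -(g * Real.log 2 / 2)) (by
      have : 0 < g * Real.log 2 := by positivity
      linarith) (2 ^ k))
  filter_upwards [eventually_ne_atTop 0] with n hn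
  refine (existenceProb_le hn hγ0.le hδ1.le (by linarith) hξ0 (hV n)).trans ?_
  have h2 : (2 : ℝ) ^ n = Real.exp (n * Real.log 2) := by
    rw [Real.exp_nat_mul, Real.exp_log two_pos]
  rw [mul_pow, h2, ← Real.exp_nat_mul]
  rw [mul_left_comm, mul_assoc, ← Real.exp_add, ← Real.exp_add]
  gcongr
  have hkh : k * h ≤ g * Real.log 2 / 4 := by
    rw [hh, ← mul_div_assoc, div_le_div_iff₀ (by positivity) (by positivity)]
    have : 0 < g * Real.log 2 := by positivity
    nlinarith
  have hn' : (0 : ℝ) ≤ n := by positivity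
  have key : Real.log 2 + k * h + γ ^ 2 * Real.log 2 * (((k : ℝ) + 1) ^ 2 * ξ ^ p - (k + 1)) ≤
      -(g * Real.log 2 / 2) := by
    have : Real.log 2 * (ξ ^ p * (4 * (γ ^ 2 * ((k : ℝ) + 1) ^ 2))) ≤ Real.log 2 * g :=
      mul_le_mul_of_nonneg_left hp'.le hl.le
    have : γ ^ 2 * Real.log 2 * (k + 1) = Real.log 2 * (g + 1) := by rw [hgdef]; ring
    linarith
  have := mul_le_mul_of_nonneg_left key hn'
  linarith

/-! ### Second moment and concentration: admissibility below 1/√m. -/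

open Classical in
/-- Second moment bound for the existence of a high-energy tuple in the gauge orbit of a given
tuple with small pairwise overlaps. -/
theorem sq_le_measureReal_iUnion (hn : n ≠ 0) {m : ℕ} (σ : Fin m → Config n) {r V c q δ : ℝ}
    (hσ : ∀ t l, t ≠ l → |overlap (σ t) (σ l)| ≤ r) (hr : 0 ≤ r) (hrδ : 1 - δ ≤ r)
    (hV : ∀ σ : Config n, (Finset.card {ε : Config n | 1 - δ < |overlap ε σ|} : ℝ) ≤ V)
    (hc : 0 ≤ c) (hq0 : 0 ≤ q)
    (hq : ∀ ε : Config n, q ≤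
      (disorderLaw n p).real {J | ∀ t, c ≤ hamiltonian J (ε * σ t)}) :
    q ^ 2 ≤ (disorderLaw n p).real (⋃ ε : Config n, {J | ∀ t, c ≤ hamiltonian J (ε * σ t)}) *
      (Real.exp (n * (c ^ 2 / 2 * (4 * m ^ 2 * r ^ p - 2 * m))) +
        (2 ^ n)⁻¹ * (m ^ 2 * V * Real.exp (n * (c ^ 2 / 2 * (m ^ 2 * r ^ p - m))))) := by
  set A : Config n → Set (Disorder n p) := fun ε => {J | ∀ t, c ≤ hamiltonian J (ε * σ t)}
    with hAdef
  have hA : ∀ ε, MeasurableSet (A ε) := fun ε =>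
    measurableSet_forall_le_hamiltonian c fun t => ε * σ t
  set E₁ := Real.exp (n * (c ^ 2 / 2 * (4 * m ^ 2 * r ^ p - 2 * m))) with hE₁
  set E₂ := Real.exp (n * (c ^ 2 / 2 * (m ^ 2 * r ^ p - m))) with hE₂
  have hs := sq_sum_measureReal_le (disorderLaw n p) hA
  have h1 : ((2 : ℝ) ^ n * q) ^ 2 ≤ (∑ ε, (disorderLaw n p).real (A ε)) ^ 2 := by
    refine pow_le_pow_left₀ (by positivity) ?_ 2
    refine le_of_eq_of_le ?_ (Finset.sum_le_sum fun ε _ => hq ε)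
    simp
  have hgauge : ∀ ε t l, t ≠ l → |overlap (ε * σ t) (ε * σ l)| ≤ r := fun ε t l h => by
    rw [overlap_mul_left]; exact hσ t l h
  have hone : ∀ ε, (disorderLaw n p).real (A ε) ≤ E₂ := by
    intro ε
    refine (measureReal_forall_le_hamiltonian_le hn hc fun t => ε * σ t).trans ?_
    have h := sum_overlap_pow_le hn (fun t => ε * σ t) (hgauge ε) hr p
    rw [hE₂, Real.exp_le_exp]
    rw [Fintype.card_fin] at h ⊢
    have h0 : (0 : ℝ) ≤ n * (c ^ 2 / 2) := by positivity
    have := mul_le_mul_of_nonneg_left (sub_le_sub_right h (2 * (m : ℝ))) h0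
    linarith
  set bad : Config n → Finset (Config n) := fun ε => {ε' : Config n |
    ∃ t l, 1 - δ < |overlap (ε * σ t) (ε' * σ l)|} with hbad
  -- A good pair is a weakly correlated 2m-tuple, giving E₁; for a bad pair the intersection is
  -- bounded by a single event, giving E₂.
  have htwo : ∀ ε ε', (disorderLaw n p).real (A ε ∩ A ε') ≤
      E₁ + if ε' ∈ bad ε then E₂ else 0 := by
    intro ε ε'
    by_cases hb : ε' ∈ bad ε
    · rw [if_pos hb]
      have := measureReal_mono (μ := disorderLaw n p) (Set.inter_subset_left (s := A ε) (t := A ε'))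
      have := Real.exp_pos (n * (c ^ 2 / 2 * (4 * m ^ 2 * r ^ p - 2 * m)))
      linarith [hone ε]
    · rw [if_neg hb, add_zero]
      have hgood : ∀ t l, |overlap (ε * σ t) (ε' * σ l)| ≤ r := by
        simp only [hbad, Finset.mem_filter, Finset.mem_univ, true_and, not_exists, not_lt] at hb
        exact fun t l => (hb t l).trans hrδ
      set ρ : Fin m ⊕ Fin m → Config n := Sum.elim (fun t => ε * σ t) fun t => ε' * σ t with hρ
      have hset : A ε ∩ A ε' = {J | ∀ t, c ≤ hamiltonian J (ρ t)} := by
        ext J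
        simp [hAdef, hρ]
      have h := sum_overlap_pow_le hn ρ (r := r) (by
        rintro (t | t) (l | l) htl
        · exact hgauge ε t l fun h => htl (by rw [h])
        · exact hgood t l
        · rw [overlap_comm]; exact hgood l t
        · exact hgauge ε' t l fun h => htl (by rw [h])) hr p
      rw [hset]
      refine (measureReal_forall_le_hamiltonian_le hn hc ρ).trans ?_
      rw [hE₁, Real.exp_le_exp]
      rw [Fintype.card_sum, Fintype.card_fin] at h ⊢
      push_cast at h ⊢
      have h0 : (0 : ℝ) ≤ n * (c ^ 2 / 2) := by positivity
      have := mul_le_mul_of_nonneg_left (sub_le_sub_right h (2 * ((m : ℝ) + m))) h0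
      linarith
  have hcard : ∀ ε, ((bad ε).card : ℝ) ≤ m ^ 2 * V := by
    intro ε
    have hsub : bad ε ⊆ Finset.univ.biUnion fun t : Fin m => Finset.univ.biUnion fun l : Fin m =>
        ({ε' : Config n | 1 - δ < |overlap ε' (ε * σ t * σ l)|} : Finset (Config n)) := by
      intro ε'
      simp [hbad, overlap_mul_mul]
    have h2 := (Finset.card_le_card hsub).trans (Finset.card_biUnion_le.trans
      (Finset.sum_le_sum fun t _ => Finset.card_biUnion_le))
    refine (Nat.cast_le.2 h2).trans ?_
    push_cast
    refine (Finset.sum_le_sum fun t _ => Finset.sum_le_sum fun l _ => hV _).trans_eq ?_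
    simp
    ring
  have h2 : ∑ ε, ∑ ε', (disorderLaw n p).real (A ε ∩ A ε') ≤
      2 ^ n * (2 ^ n * E₁ + m ^ 2 * V * E₂) := by
    calc ∑ ε, ∑ ε', (disorderLaw n p).real (A ε ∩ A ε')
        ≤ ∑ ε : Config n, (2 ^ n * E₁ + m ^ 2 * V * E₂) := by
          refine Finset.sum_le_sum fun ε _ => (Finset.sum_le_sum fun ε' _ => htwo ε ε').trans ?_
          rw [Finset.sum_add_distrib, Finset.sum_const, Finset.sum_ite_mem, Finset.univ_inter,
            Finset.sum_const, nsmul_eq_mul, nsmul_eq_mul]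
          refine add_le_add (by simp) ?_
          exact mul_le_mul_of_nonneg_right (hcard ε) (Real.exp_pos _).le
      _ = _ := by
          simp
          ring
  have h3 := h1.trans (hs.trans (mul_le_mul_of_nonneg_left h2 measureReal_nonneg))
  have h4 : (0 : ℝ) < (2 ^ n) ^ 2 := by positivity
  rw [mul_pow] at h3
  refine le_of_mul_le_mul_left (h3.trans_eq ?_) h4
  field_simp

/-- Energies are Lipschitz in the disorder, so by Gaussian isoperimetry a not too unlikely event
of existence of a tuple becomes likely once the energy level is lowered. -/
theorem measureReal_mul_one_sub_existenceProb_le (hn : n ≠ 0) {m : ℕ} (σ : Fin m → Config n)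
    {γ ξ η c : ℝ} (hσ : ∀ t l, t ≠ l → overlap (σ t) (σ l) ∈ Set.Icc (ξ - η) ξ)
    (hc : γ * Real.sqrt (2 * Real.log 2) ≤ c) :
    (disorderLaw n p).real (⋃ ε : Config n, {J | ∀ t, c ≤ hamiltonian J (ε * σ t)}) *
      (1 - existenceProb n p γ m ξ η) ≤
        Real.exp (-(n * (c - γ * Real.sqrt (2 * Real.log 2)) ^ 2) / 4) := by
  have hm := measurableSet_solutionTuples_nonempty (n := n) (p := p) γ m ξ η
  rw [existenceProb, ← probReal_compl_eq_one_sub hm]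
  refine gaussian_mul_le_exp_neg
    (MeasurableSet.iUnion fun ε => measurableSet_forall_le_hamiltonian c fun t => ε * σ t)
    hm.compl fun J hJ J' hJ' => ?_
  obtain ⟨ε, hε⟩ := Set.mem_iUnion.1 hJ
  have hex : ∃ t, hamiltonian J' (ε * σ t) < γ * Real.sqrt (2 * Real.log 2) := by
    by_contra! hcon
    exact hJ' ⟨fun t => ε * σ t, hcon, fun t l htl => by
      rw [overlap_mul_left]; exact hσ t l htl.ne⟩
  obtain ⟨t, ht⟩ := hex
  refine le_trans ?_ (sq_hamiltonian_sub_le hn J J' (ε * σ t))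
  have h1 : c ≤ hamiltonian J (ε * σ t) := hε t
  have h2 : (0 : ℝ) ≤ c - γ * Real.sqrt (2 * Real.log 2) := sub_nonneg.2 hc
  gcongr

theorem mAdmissible_of_lt {m : ℕ} (hm : 1 ≤ m) {γ : ℝ} (hγ0 : 0 < γ)
    (hγ : γ < 1 / Real.sqrt m) : MAdmissible m γ := by
  intro ξ η hη hηξ hξ
  have hl : 0 < Real.log 2 := Real.log_pos one_lt_two
  have hm0 : (0 : ℝ) < m := by exact_mod_cast hm
  obtain ⟨γ', hγγ', hγ'⟩ := exists_between hγ
  have hγ'0 : 0 < γ' := hγ0.trans hγγ'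
  have hg : 0 < 1 - m * γ' ^ 2 := by
    rw [lt_div_iff₀ (Real.sqrt_pos.2 hm0)] at hγ'
    have := Real.sq_sqrt hm0.le
    have h0 : 0 ≤ γ' * Real.sqrt m := by positivity
    nlinarith
  have hs0 : 0 < Real.sqrt (2 * Real.log 2) := Real.sqrt_pos.2 (by positivity)
  set c₀ := γ * Real.sqrt (2 * Real.log 2) with hc₀
  set c := γ' * Real.sqrt (2 * Real.log 2) with hc
  have hcc : c₀ < c := mul_lt_mul_of_pos_right hγγ' hs0
  have hc_pos : 0 < c := by positivity
  have hc2 : c ^ 2 = 2 * (γ' ^ 2 * Real.log 2) := by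
    rw [hc, mul_pow, Real.sq_sqrt (by positivity)]; ring
  -- Half the isoperimetric exponent (c - c₀)²/4: a second moment bound of order e^(-ns) still
  -- leaves decay e^(-ns).
  set s := (c - c₀) ^ 2 / 8 with hs
  have hs_pos : 0 < s := by
    have := sub_pos.2 hcc
    positivity
  set h := (1 - m * γ' ^ 2) * Real.log 2 / 2 with hh
  have hh0 : 0 < h := by positivity
  obtain ⟨δ, hδ0, hδ1, hV⟩ := exists_card_lt_abs_overlap_le hh0
  set r := max ξ (1 - δ) with hr
  have hr0 : 0 ≤ r := le_max_of_le_left (by linarith)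
  have hr1 : r < 1 := max_lt hξ (by linarith)
  -- The square of the single-tuple lower bound decays like e^(-nQ); ρ stands for r^p.
  set Q : ℝ → ℝ → ℝ := fun κ ρ => (c + κ) ^ 2 * (m + m ^ 2 * ρ) * (1 + 2 * κ) with hQ
  -- The two exponents of the second moment are negligible for small `κ` and `ρ`.
  have hF1 : ∀ᶠ x : ℝ × ℝ in 𝓝 (0, 0),
      Q x.1 x.2 + c ^ 2 / 2 * (4 * m ^ 2 * x.2 - 2 * m) < s := by
    have hcont : Continuous fun x : ℝ × ℝ =>
      Q x.1 x.2 + c ^ 2 / 2 * (4 * m ^ 2 * x.2 - 2 * m) := by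
      simp only [hQ]
      fun_prop
    refine hcont.continuousAt.eventually_lt continuousAt_const ?_
    simp only [hQ]
    ring_nf
    exact hs_pos
  have hF2 : ∀ᶠ x : ℝ × ℝ in 𝓝 (0, 0),
      Q x.1 x.2 + c ^ 2 / 2 * (m ^ 2 * x.2 - m) + h - Real.log 2 < 0 := by
    have hcont : Continuous fun x : ℝ × ℝ =>
      Q x.1 x.2 + c ^ 2 / 2 * (m ^ 2 * x.2 - m) + h - Real.log 2 := by
      simp only [hQ]
      fun_prop
    refine hcont.continuousAt.eventually_lt continuousAt_const ?_
    simp only [hQ]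
    -- At the origin Q = mc² = 2mγ'² log 2, so the exponent equals -h: half of the entropy gap is
    -- left over.
    have : h = Real.log 2 / 2 - m * (c ^ 2 / 4) := by rw [hh, hc2]; ring
    have : 0 < h := hh0
    nlinarith
  obtain ⟨u, hu, v, hv, huv⟩ : ∃ u > (0 : ℝ), ∃ v > (0 : ℝ), ∀ κ ρ, |κ| < u → |ρ| < v →
      Q κ ρ + c ^ 2 / 2 * (4 * m ^ 2 * ρ - 2 * m) < s ∧
      Q κ ρ + c ^ 2 / 2 * (m ^ 2 * ρ - m) + h - Real.log 2 < 0 := by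
    obtain ⟨e, he, H⟩ := Metric.eventually_nhds_iff.1 (hF1.and hF2)
    refine ⟨e, he, e, he, fun κ ρ hκ hρ => H (y := (κ, ρ)) ?_⟩
    simpa [Prod.dist_eq] using ⟨hκ, hρ⟩
  set κ := u / 2 with hκ
  have hκ0 : 0 < κ := by positivity
  obtain ⟨P, hP⟩ := ((tendsto_pow_atTop_nhds_zero_of_lt_one hr0 hr1).eventually_lt_const
    hv).exists_forall_of_atTop
  refine ⟨P, fun p hp => ?_⟩
  have hρ0 : 0 ≤ r ^ p := pow_nonneg hr0 p
  obtain ⟨hQ1, hQ2⟩ := huv κ (r ^ p) (by rw [abs_of_pos hκ0]; linarith)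
    (by rw [abs_of_nonneg hρ0]; exact hP p hp)
  have hlow : ∀ᶠ n : ℕ in atTop, (m : ℝ) * Real.exp (n * -(κ ^ 2 / 2)) +
      1 * Real.exp (n * -(c ^ 2 * κ ^ 2 / 2)) < 1 / 2 := by
    have := (tendsto_exp_natCast_mul_nhds_zero (a := -(κ ^ 2 / 2))
      (neg_neg_of_pos (by positivity)) m).add
      (tendsto_exp_natCast_mul_nhds_zero (a := -(c ^ 2 * κ ^ 2 / 2))
      (neg_neg_of_pos (by positivity)) 1)
    rw [add_zero] at this
    exact this.eventually_lt_const (by norm_num)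
  have hmain : ∀ᶠ n : ℕ in atTop, 1 - existenceProb n p γ m ξ η ≤
      4 * (1 + 2 * m ^ 2) * Real.exp (n * -s) := by
    filter_upwards [eventually_ne_atTop 0, hlow, eventually_exists_overlap_mem_Icc m hη hηξ hξ]
      with n hn hlow ⟨σ, hσ⟩
    -- Here η < ξ matters: the tail lower bound needs nonnegative correlations.
    have hov : ∀ t l, 0 ≤ overlap (σ t) (σ l) := by
      intro t l
      rcases eq_or_ne t l with rfl | htl
      · simp [overlap_self hn]
      · linarith [(hσ t l htl).1]
    have hσr : ∀ t l, t ≠ l → |overlap (σ t) (σ l)| ≤ r := fun t l htl => by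
      rw [abs_of_nonneg (hov t l)]
      exact (hσ t l htl).2.trans (le_max_left _ _)
    have hq : ∀ ε : Config n, 1 / 2 * Real.exp (-(n * Q κ (r ^ p) / 2)) ≤
        (disorderLaw n p).real {J | ∀ t, c ≤ hamiltonian J (ε * σ t)} := by
      intro ε
      set G := ∑ t, ∑ l, overlap (ε * σ t) (ε * σ l) ^ p with hG
      have hGle := sum_overlap_pow_le hn (fun t => ε * σ t) (r := r) (fun t l htl => by
        rw [overlap_mul_left]; exact hσr t l htl) hr0 p
      rw [Fintype.card_fin, ← hG] at hGle
      have hGge : 1 ≤ G := by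
        have t₀ : Fin m := ⟨0, hm⟩
        have hnn : ∀ t l, 0 ≤ overlap (ε * σ t) (ε * σ l) ^ p := fun t l => by
          rw [overlap_mul_left]; exact pow_nonneg (hov t l) p
        calc (1 : ℝ) = overlap (ε * σ t₀) (ε * σ t₀) ^ p := by rw [overlap_self hn, one_pow]
          _ ≤ ∑ l, overlap (ε * σ t₀) (ε * σ l) ^ p :=
            Finset.single_le_sum (f := fun l => overlap (ε * σ t₀) (ε * σ l) ^ p)
              (fun l _ => hnn t₀ l) (Finset.mem_univ t₀)
          _ ≤ G := Finset.single_le_sum (f := fun t => ∑ l, overlap (ε * σ t) (ε * σ l) ^ p)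
              (fun t _ => Finset.sum_nonneg fun l _ => hnn t l) (Finset.mem_univ t₀)
      refine le_trans ?_ (le_measureReal_forall_le_hamiltonian hn hc_pos.le hκ0.le
        (fun t => ε * σ t) (fun t l => by rw [overlap_mul_left]; exact hov t l) hG)
      rw [Fintype.card_fin, mul_comm (1 / 2 : ℝ)]
      refine mul_le_mul ?_ ?_ (by norm_num) (Real.exp_pos _).le
      · rw [Real.exp_le_exp]
        have h0 : (0 : ℝ) ≤ n * (c + κ) ^ 2 * (1 / 2 + κ) := by positivity
        have := mul_le_mul_of_nonneg_left hGle h0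
        simp only [hQ]
        linarith
      · have e1 : Real.exp (-(n * (c + κ) ^ 2 * G * κ ^ 2 / 2)) ≤
            Real.exp (n * -(c ^ 2 * κ ^ 2 / 2)) := by
          rw [Real.exp_le_exp]
          have h1 : c ^ 2 * 1 ≤ (c + κ) ^ 2 * G :=
            mul_le_mul (pow_le_pow_left₀ hc_pos.le (by linarith) 2) hGge zero_le_one (by positivity)
          have := mul_le_mul_of_nonneg_left h1 (show (0 : ℝ) ≤ n * κ ^ 2 / 2 by positivity)
          linarith
        have e2 : Real.exp (-(n * κ ^ 2 / 2)) = Real.exp (n * -(κ ^ 2 / 2)) := by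
          congr 1; ring
        rw [e2]
        linarith
    have hsm := sq_le_measureReal_iUnion hn σ hσr hr0 (le_max_right _ _) (hV n) hc_pos.le
      (by positivity) hq
    have hconc := measureReal_mul_one_sub_existenceProb_le (p := p) hn σ hσ hcc.le
    rw [← hc₀] at hconc
    set U := (disorderLaw n p).real
      (⋃ ε : Config n, {J | ∀ t, c ≤ hamiltonian J (ε * σ t)})
    have hU0 : 0 ≤ U := measureReal_nonneg
    set D := 1 - existenceProb n p γ m ξ η with hD
    have hD0 : 0 ≤ D := sub_nonneg.2 (existenceProb_le_one _ _ _ _ _ _)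
    have h2 : ((2 : ℝ) ^ n)⁻¹ = Real.exp (n * -Real.log 2) := by
      rw [mul_neg, Real.exp_neg, Real.exp_nat_mul, Real.exp_log two_pos]
    have hsq : (1 / 2 * Real.exp (-(n * Q κ (r ^ p) / 2))) ^ 2 =
        1 / 4 * Real.exp (-(n * Q κ (r ^ p))) := by
      rw [mul_pow, ← Real.exp_nat_mul]
      congr 1
      · norm_num
      · congr 1; push_cast; ring
    have hn' : (0 : ℝ) ≤ n := by positivity
    have hbd : Real.exp (n * (c ^ 2 / 2 * (4 * m ^ 2 * r ^ p - 2 * m))) +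
        (2 ^ n)⁻¹ * (m ^ 2 * (2 * Real.exp (h * n)) *
          Real.exp (n * (c ^ 2 / 2 * (m ^ 2 * r ^ p - m)))) ≤
        (1 + 2 * m ^ 2) * (Real.exp (n * s) * Real.exp (-(n * Q κ (r ^ p)))) := by
      have b1 : Real.exp (n * (c ^ 2 / 2 * (4 * m ^ 2 * r ^ p - 2 * m))) ≤
          Real.exp (n * s) * Real.exp (-(n * Q κ (r ^ p))) := by
        rw [← Real.exp_add, Real.exp_le_exp]
        have := mul_le_mul_of_nonneg_left hQ1.le hn'
        linarith
      have b2 : (2 ^ n)⁻¹ * (m ^ 2 * (2 * Real.exp (h * n)) *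
          Real.exp (n * (c ^ 2 / 2 * (m ^ 2 * r ^ p - m)))) ≤
          2 * m ^ 2 * (Real.exp (n * s) * Real.exp (-(n * Q κ (r ^ p)))) := by
        rw [h2]
        calc _ = 2 * (m : ℝ) ^ 2 * (Real.exp (n * -Real.log 2) * (Real.exp (h * n) *
              Real.exp (n * (c ^ 2 / 2 * (m ^ 2 * r ^ p - m))))) := by ring
          _ ≤ _ := by
            rw [← Real.exp_add, ← Real.exp_add, ← Real.exp_add]
            refine mul_le_mul_of_nonneg_left (Real.exp_le_exp.2 ?_) (by positivity)
            have := mul_le_mul_of_nonneg_left hQ2.le hn'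
            have : 0 ≤ n * s := by positivity
            linarith
      linarith
    rw [hsq] at hsm
    have h3 := hsm.trans (mul_le_mul_of_nonneg_left hbd hU0)
    have hUlow : 1 ≤ 4 * (1 + 2 * m ^ 2) * Real.exp (n * s) * U := by
      have := Real.exp_pos (-(n * Q κ (r ^ p)))
      refine le_of_mul_le_mul_right ?_ this
      linarith
    calc D = 1 * D := (one_mul D).symm
      _ ≤ 4 * (1 + 2 * m ^ 2) * Real.exp (n * s) * U * D := mul_le_mul_of_nonneg_right hUlow hD0
      _ = 4 * (1 + 2 * m ^ 2) * Real.exp (n * s) * (U * D) := by ring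
      _ ≤ 4 * (1 + 2 * m ^ 2) * Real.exp (n * s) * Real.exp (-(n * (c - c₀) ^ 2) / 4) := by gcongr
      _ = 4 * (1 + 2 * m ^ 2) * Real.exp (n * -s) := by
        rw [mul_assoc, ← Real.exp_add, hs]
        congr 2
        ring
  have hlim : Tendsto (fun n : ℕ => 1 - existenceProb n p γ m ξ η) atTop (𝓝 0) :=
    squeeze_zero' (.of_forall fun n => sub_nonneg.2 (existenceProb_le_one _ _ _ _ _ _)) hmain
      (tendsto_exp_natCast_mul_nhds_zero (neg_neg_of_pos hs_pos) _)
  simpa using hlim.const_sub 1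

theorem MAdmissible.not_mInadmissible {m : ℕ} {γ : ℝ} (h : MAdmissible m γ) :
    ¬ MInadmissible m γ := by
  rintro ⟨ξ, η, hη, hηξ, hξ, P, hP⟩
  obtain ⟨P', hP'⟩ := h ξ η hη hηξ hξ
  exact zero_ne_one (tendsto_nhds_unique (hP (max P P') (le_max_left _ _) η hη le_rfl)
    (hP' (max P P') (le_max_right _ _)))

end PSpin

end

theorem mainTheorem1 (m : ℕ) (hm : 1 ≤ m) :
    PSpin.SharpPhaseTransition m (1 / Real.sqrt (m : ℝ)) ∧
      (∀ γ : ℝ, 0 < γ → γ < 1 / Real.sqrt (m : ℝ) → PSpin.MAdmissible m γ) ∧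
      (∀ γ : ℝ, 1 / Real.sqrt (m : ℝ) < γ → PSpin.MInadmissible m γ) := by
  have hadm : ∀ γ : ℝ, 0 < γ → γ < 1 / Real.sqrt (m : ℝ) → PSpin.MAdmissible m γ :=
    fun γ h0 h => PSpin.mAdmissible_of_lt hm h0 h
  have hinadm : ∀ γ : ℝ, 1 / Real.sqrt (m : ℝ) < γ → PSpin.MInadmissible m γ :=
    fun γ h => PSpin.mInadmissible_of_lt hm h
  have hpos : 0 < 1 / Real.sqrt (m : ℝ) := by
    have : (0 : ℝ) < m := by exact_mod_cast hm
    positivity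
  refine ⟨⟨⟨?_, ?_⟩, ?_, ?_⟩, hadm, hinadm⟩
  · rintro γ ⟨-, hγ⟩
    by_contra! hlt
    exact hγ.not_mInadmissible (hinadm γ hlt)
  · intro b hb
    refine le_of_forall_lt fun a ha => ?_
    -- The maximum with 0 keeps γ positive when a is negative.
    obtain ⟨γ, h1, h2⟩ := exists_between (max_lt ha hpos)
    exact ((le_max_left _ _).trans_lt h1).trans_le
      (hb ⟨(le_max_right _ _).trans_lt h1, hadm γ ((le_max_right _ _).trans_lt h1) h2⟩)
  · rintro γ ⟨h0, hγ⟩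
    by_contra! hlt
    exact (hadm γ h0 hlt).not_mInadmissible hγ
  · intro b hb
    refine le_of_forall_gt fun a ha => ?_
    obtain ⟨γ, h1, h2⟩ := exists_between ha
    exact (hb ⟨hpos.trans h1, hinadm γ h1⟩).trans_lt h2
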